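/- **Conventions.** Let $n,m\ge 0$. Every function $f\colon\{-1,1\}^n\to\mathbb R$ is identified with its unique multilinear polynomial $\sum_{S\subseteq[n]}\hat f(S)\prod_{i\in S}x_i$, so it may be evaluated at real points; $\operatorname{supp}\hat f=\{S:\hat f(S)\ne0\}$, $\deg f$ is the degree of this polynomial, and $\operatorname{Dep}(f)$ is the set of coordinates on which $f$ depends. A *dictator* is a non-constant function depending on a single coordinate. A function $f$ is *Boolean-like* if (a) $\deg f=1$ if and only if $f$ is a dictator; (b) if $f$ is not a dictator then every $w\in\operatorname{Dep}(f)$ belongs to some $S\in\operatorname{supp}\hat f$ with $|S|\ge2$; (c) $\deg f=1$ if and only if $f=\pm x_i$ for some $i$. If $f=\pm x_i$, its sign $\operatorname{sgn}(f)\in\{-1,1\}$ is defined by $f=\operatorname{sgn}(f)x_i$. Functions $f_0,f_1,\dots,f_m\colon\{-1,1\}^n\to\mathbb R$ and $g_0,g_1,\dots,g_n\colon\{-1,1\}^m\to\mathbb R$ form a *generalized polymorphism* if for every $Z=(z_{ij})\in\{-1,1\}^{n\times m}$ $$g_0\bigl(f_1(z_{11},\dots,z_{n1}),\dots,f_m(z_{1m},\dots,z_{nm})\bigr)=f_0\bigl(g_1(z_{11},\dots,z_{1m}),\dots,g_n(z_{n1},\dots,z_{nm})\bigr).$$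 For a set $W$ of entries $z_{ij}$ let $\operatorname{rows}(W)$, $\operatorname{cols}(W)$ be the sets of rows and columns that meet $W$; let $\operatorname{rows}_{\ge2}(W)$ consist of the $i\in\operatorname{rows}(W)$ with $\deg g_i\ge2$, and $\operatorname{cols}_{\ge2}(W)$ of the $j\in\operatorname{cols}(W)$ with $\deg f_j\ge2$. Let $\operatorname{Dep}_{=1}(f_j)$, $\operatorname{Dep}_{\ge2}(f_j)$ be the sets of $i\in\operatorname{Dep}(f_j)$ with $\deg g_i=1$, respectively $\deg g_i\ge2$; let $\operatorname{Dep}_{=1}(g_i)$, $\operatorname{Dep}_{\ge2}(g_i)$ be the sets of $j\in\operatorname{Dep}(g_i)$ with $\deg f_j=1$, respectively $\deg f_j\ge2$. For $x\in\{-1,1\}^n$, the vector $x^{\operatorname{sgn}}$ arises from $x$ by replacing $x_i$ by $\operatorname{sgn}(g_i)x_i$ whenever $\deg g_i=1$; for $y\in\{-1,1\}^m$, the vector $y^{\operatorname{sgn}}$ arises from $y$ by replacing $y_j$ by $\operatorname{sgn}(f_j)y_j$ whenever $\deg f_j=1$. **Data.** Given the functions above, consider: 1. a set $Z_0$ of entries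 and a partition $Z_0=\bigsqcup_{\ell=1}^kZ_\ell$ into non-empty blocks which are pairwise disjoint in rows and in columns, such that for all $\ell$, $i\in\operatorname{rows}(Z_\ell)$, $j\in\operatorname{cols}(Z_\ell)$: $\operatorname{Dep}(g_i)\subseteq\operatorname{cols}(Z_\ell)$, $\operatorname{Dep}(f_j)\subseteq\operatorname{rows}(Z_\ell)$, and $j\in\operatorname{Dep}(g_i)\iff i\in\operatorname{Dep}(f_j)$; 2. a multilinear polynomial $h\colon\mathbb R^k\to\mathbb R$ depending on all its coordinates; 3. functions $\phi_j\colon\{-1,1\}^{\operatorname{Dep}_{=1}(f_j)}\to\mathbb R$ and $\gamma_i\colon\{-1,1\}^{\operatorname{Dep}_{=1}(g_i)}\to\mathbb R$ for $j\in\operatorname{cols}(Z_0)$, $i\in\operatorname{rows}(Z_0)$; 4. real constants $D_i$, $B_j$, $\kappa_{ij}$ with $D_i=0$ if $\deg g_i=1$, $B_j=0$ if $\deg f_j=1$, and $\kappa_{ij}=0$ if $\deg g_i=1$ or $\deg f_j=1$. We say that $f_0,\dots,f_m,g_0,\dots,g_n$ *are given by the data* if for all $j\in\operatorname{cols}(Z_0)$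 and $i\in\operatorname{rows}(Z_0)$ $$f_j(x)=\prod_{i'\in\operatorname{Dep}_{\ge2}(f_j)}(x_{i'}+\kappa_{i'j})\cdot\phi_j\bigl(x|_{\operatorname{Dep}_{=1}(f_j)}\bigr)+B_j,\qquad g_i(y)=\prod_{j'\in\operatorname{Dep}_{\ge2}(g_i)}(y_{j'}+\kappa_{ij'})\cdot\gamma_i\bigl(y|_{\operatorname{Dep}_{=1}(g_i)}\bigr)+D_i,$$ and $f_0=h(f_0^{(1)},\dots,f_0^{(k)})$, $g_0=h(g_0^{(1)},\dots,g_0^{(k)})$, where, if $|Z_\ell|>1$, $$f_0^{(\ell)}(x)=\prod_{i\in\operatorname{rows}_{\ge2}(Z_\ell)}(x_i-D_i)\prod_{j\in\operatorname{cols}_{\ge2}(Z_\ell)}\phi_j\bigl(x^{\operatorname{sgn}}|_{\operatorname{Dep}_{=1}(f_j)}\bigr),\qquad g_0^{(\ell)}(y)=\prod_{j\in\operatorname{cols}_{\ge2}(Z_\ell)}(y_j-B_j)\prod_{i\in\operatorname{rows}_{\ge2}(Z_\ell)}\gamma_i\bigl(y^{\operatorname{sgn}}|_{\operatorname{Dep}_{=1}(g_i)}\bigr),$$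 while $f_0^{(\ell)}(x)=\operatorname{sgn}(f_j)x_i$ and $g_0^{(\ell)}(y)=\operatorname{sgn}(g_i)y_j$ if $Z_\ell=\{z_{ij}\}$. **Theorem.** (Direct part.) Let $f_0,\dots,f_m,g_0,\dots,g_n$ be a generalized polymorphism such that $f_0$ and $g_0$ depend on all their inputs and $f_1,\dots,f_m,g_1,\dots,g_n$ are Boolean-like and non-constant. Then $f_0,\dots,f_m,g_0,\dots,g_n$ are given by some data as above. Moreover, one can take $Z_0$ to be the set of entries on which $f_0\circ(g_1,\dots,g_n)$ depends, which meets every row and every column, and $Z_1,\dots,Z_k$ to be its connected components when distinct entries in a common row or column are joined by an edge. (Converse.) Suppose that $f_0,\dots,f_m,g_0,\dots,g_n$ are given by some data as above, and that each $f_j$ with $j\in\operatorname{cols}(Z_0)$ and each $g_i$ with $i\in\operatorname{rows}(Z_0)$ either equals $\pm$ one of its inputs or has degree at least $2$ (as is the case when these functions are Boolean-like and non-constant). Then $f_0,\dots,f_m,g_0,\dots,g_n$ is a generalized polymorphism. -/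

import Mathlib

namespace GenPoly

/-- The Boolean cube `{-1,1}^ι`. -/
abbrev Cube (ι : Type*) := ι → ℤˣ

/-- The inclusion of `{-1,1}` into the reals. -/
def toReal (s : ℤˣ) : ℝ := ((s : ℤ) : ℝ)

section Functions

variable {ι : Type*} [Fintype ι] [DecidableEq ι]

/-- The Fourier coefficient `E_x [f(x) χ_S(x)]`, where `χ_S(x) = ∏ i ∈ S, x_i`. -/
noncomputable def fourierCoeff (f : Cube ι → ℝ) (S : Finset ι) : ℝ :=
  (∑ x : Cube ι, f x * ∏ i ∈ S, toReal (x i)) / 2 ^ Fintype.card ι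

/-- The multilinear polynomial `∑ S, f̂(S) ∏ i ∈ S, x_i` with which a function on the cube is
identified, evaluated at an arbitrary real point. -/
noncomputable def multilinearExt (f : Cube ι → ℝ) (x : ι → ℝ) : ℝ :=
  ∑ S : Finset ι, fourierCoeff f S * ∏ i ∈ S, x i

/-- The Fourier expansion: the multilinear polynomial of `f` agrees with `f` on the cube. -/
theorem multilinearExt_toReal (f : Cube ι → ℝ) (x : Cube ι) :
    multilinearExt f (fun i => toReal (x i)) = f x := by
  have key : ∀ a : Cube ι, ∑ S : Finset ι, (∏ i ∈ S, toReal (a i)) * ∏ i ∈ S, toReal (x i) =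
      if a = x then (2 : ℝ) ^ Fintype.card ι else 0 := by
    intro a
    have h1 : ∑ S : Finset ι, (∏ i ∈ S, toReal (a i)) * ∏ i ∈ S, toReal (x i) =
        ∏ i, (1 + toReal (a i) * toReal (x i)) := by
      rw [Finset.prod_one_add, Finset.powerset_univ]
      exact Finset.sum_congr rfl fun S _ => Finset.prod_mul_distrib.symm
    rw [h1]
    split_ifs with h
    · subst h
      have : ∀ i, 1 + toReal (a i) * toReal (a i) = 2 := by
        intro i
        rcases Int.units_eq_one_or (a i) with h | h <;> rw [h] <;> norm_num [toReal]
      simp [this]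
    · obtain ⟨i, hi⟩ := Function.ne_iff.1 h
      refine Finset.prod_eq_zero (Finset.mem_univ i) ?_
      rcases Int.units_eq_one_or (a i) with h | h <;>
        rcases Int.units_eq_one_or (x i) with h' | h' <;> rw [h, h'] at hi ⊢ <;>
        first | exact absurd rfl hi | norm_num [toReal]
  have h2 : (2 : ℝ) ^ Fintype.card ι ≠ 0 := by positivity
  unfold multilinearExt fourierCoeff
  simp only [div_mul_eq_mul_div, Finset.sum_mul, ← Finset.sum_div]
  rw [Finset.sum_comm, div_eq_iff h2]
  simp only [mul_assoc, ← Finset.mul_sum, key]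
  simp

/-- The family of sets `S` with `f̂(S) ≠ 0`. -/
noncomputable def fourierSupport (f : Cube ι → ℝ) : Finset (Finset ι) := by
  classical exact Finset.univ.filter fun S => fourierCoeff f S ≠ 0

/-- The degree of the multilinear polynomial of `f` (`0` for the zero function). -/
noncomputable def deg (f : Cube ι → ℝ) : ℕ := (fourierSupport f).sup Finset.card

/-- The set of relevant coordinates of `f`. -/
noncomputable def dep (f : Cube ι → ℝ) : Finset ι := by
  classical exact Finset.univ.filter fun i =>
    ∃ x : Cube ι, f (Function.update x i 1) ≠ f (Function.update x i (-1))

/-- `f` is not constant. -/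
def NonConstant (f : Cube ι → ℝ) : Prop := ∃ x y, f x ≠ f y

/-- `f` is non-constant and depends on a single coordinate. -/
def IsDictator (f : Cube ι → ℝ) : Prop := ∃ i, dep f = {i}

/-- `f` is one of the inputs or the negation of one of the inputs. -/
def IsSignedInput (f : Cube ι → ℝ) : Prop :=
  ∃ (s : ℤˣ) (i : ι), ∀ x, f x = toReal (s * x i)

/-- The 2-valued-like property. -/
def IsTwoValuedLike (f : Cube ι → ℝ) : Prop :=
  (deg f = 1 ↔ IsDictator f) ∧
    (¬ IsDictator f → ∀ w ∈ dep f, ∃ S ∈ fourierSupport f, 2 ≤ S.card ∧ w ∈ S)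

/-- The Boolean-like property. -/
def IsBooleanLike (f : Cube ι → ℝ) : Prop :=
  IsTwoValuedLike f ∧ (deg f = 1 ↔ IsSignedInput f)

/-- The sign of a function of the form `± x_i`: it is `-1` if `f = - x_i` for some `i`, and `1` if
`f = x_i` for some `i`. It is only used for functions of one of these two forms. -/
noncomputable def sgn (f : Cube ι → ℝ) : ℤˣ := by
  classical exact if ∃ i : ι, ∀ x, f x = toReal (-(x i)) then -1 else 1

end Functions

section Polymorphisms

variable {n m : ℕ}

/-- `f₀ ∘ (g₁, …, gₙ)` as a function of the `n × m` matrix of variables `Z`. -/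
noncomputable def rowComp (f₀ : Cube (Fin n) → ℝ) (g : Fin n → Cube (Fin m) → ℝ)
    (Z : Cube (Fin n × Fin m)) : ℝ :=
  multilinearExt f₀ fun i => g i fun j => Z (i, j)

/-- `g₀ ∘ (f₁, …, fₘ)` as a function of the `n × m` matrix of variables `Z`. -/
noncomputable def colComp (g₀ : Cube (Fin m) → ℝ) (f : Fin m → Cube (Fin n) → ℝ)
    (Z : Cube (Fin n × Fin m)) : ℝ :=
  multilinearExt g₀ fun j => f j fun i => Z (i, j)

/-- Multilinear generalized polymorphisms. -/
def IsGenPolymorphism (f₀ : Cube (Fin n) → ℝ) (f : Fin m → Cube (Fin n) → ℝ)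
    (g₀ : Cube (Fin m) → ℝ) (g : Fin n → Cube (Fin m) → ℝ) : Prop :=
  ∀ Z : Cube (Fin n × Fin m), colComp g₀ f Z = rowComp f₀ g Z

/-- The rows that meet a set of entries. -/
def rows (W : Finset (Fin n × Fin m)) : Finset (Fin n) := W.image Prod.fst

/-- The columns that meet a set of entries. -/
def cols (W : Finset (Fin n × Fin m)) : Finset (Fin m) := W.image Prod.snd

/-- For a family `v`, the indices in `I` whose function has degree `1`. -/
noncomputable def degOne {α β : Type*} [Fintype β] [DecidableEq β]
    (v : α → Cube β → ℝ) (I : Finset α) : Finset α := I.filter fun a => deg (v a) = 1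

/-- For a family `v`, the indices in `I` whose function has degree at least `2`. -/
noncomputable def degTwo {α β : Type*} [Fintype β] [DecidableEq β]
    (v : α → Cube β → ℝ) (I : Finset α) : Finset α := I.filter fun a => 2 ≤ deg (v a)

/-- The vector `x^sgn`: the entry `x_i` is multiplied by the sign of `v_i` whenever `v_i` has
degree `1`. -/
noncomputable def signed {α β : Type*} [Fintype β] [DecidableEq β]
    (v : α → Cube β → ℝ) (x : Cube α) : Cube α :=
  fun a => if deg (v a) = 1 then sgn (v a) * x a else x a

/-- The parameters of the characterization: the set `Z₀`, its blocks `Z₁, …, Z_k`, the multilinear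
function `h`, the functions `φ_j` and `γ_i`, and the real constants. Here `degOne g (dep (f j))` is
`Dep_{=1}(f_j)` and `degOne f (dep (g i))` is `Dep_{=1}(g_i)`. -/
structure Params (f : Fin m → Cube (Fin n) → ℝ) (g : Fin n → Cube (Fin m) → ℝ) where
  Z₀ : Finset (Fin n × Fin m)
  k : ℕ
  Z : Fin k → Finset (Fin n × Fin m)
  h : Cube (Fin k) → ℝ
  φ : (j : Fin m) → Cube (degOne g (dep (f j))) → ℝ
  γ : (i : Fin n) → Cube (degOne f (dep (g i))) → ℝ
  B : Fin m → ℝ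
  D : Fin n → ℝ
  κ : Fin n → Fin m → ℝ

namespace Params

variable {f : Fin m → Cube (Fin n) → ℝ} {g : Fin n → Cube (Fin m) → ℝ}

/-- The blocks partition `Z₀`, are disjoint in rows and in columns, and are compatible with the
dependencies of the functions `f_j` and `g_i`. -/
structure IsBlockPartition (d : Params f g) : Prop where
  nonempty : ∀ ℓ, (d.Z ℓ).Nonempty
  union : d.Z₀ = Finset.univ.biUnion d.Z
  rows_disjoint : ∀ ℓ ℓ', ℓ ≠ ℓ' → Disjoint (rows (d.Z ℓ)) (rows (d.Z ℓ'))
  cols_disjoint : ∀ ℓ ℓ', ℓ ≠ ℓ' → Disjoint (cols (d.Z ℓ)) (cols (d.Z ℓ'))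
  dep_row : ∀ ℓ, ∀ i ∈ rows (d.Z ℓ), dep (g i) ⊆ cols (d.Z ℓ)
  dep_col : ∀ ℓ, ∀ j ∈ cols (d.Z ℓ), dep (f j) ⊆ rows (d.Z ℓ)
  dep_iff : ∀ ℓ, ∀ i ∈ rows (d.Z ℓ), ∀ j ∈ cols (d.Z ℓ), (j ∈ dep (g i) ↔ i ∈ dep (f j))

/-- Each block is connected when two entries in a common row or column are joined by an edge. For
pairwise row- and column-disjoint blocks this says that the blocks are the connected components
of `Z₀`. -/
def IsConnected (d : Params f g) : Prop :=
  ∀ ℓ, ∀ p ∈ d.Z ℓ, ∀ q ∈ d.Z ℓ,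
    Relation.ReflTransGen (fun a b => b ∈ d.Z ℓ ∧ (a.1 = b.1 ∨ a.2 = b.2)) p q

/-- The function `h` depends on all its inputs, and the constants attached to functions of
degree `1` vanish. -/
structure IsNormalized (d : Params f g) : Prop where
  h_dep : dep d.h = Finset.univ
  D_zero : ∀ i, deg (g i) = 1 → d.D i = 0
  B_zero : ∀ j, deg (f j) = 1 → d.B j = 0
  κ_zero : ∀ i j, deg (g i) = 1 ∨ deg (f j) = 1 → d.κ i j = 0

/-- The block function `f₀^(ℓ)`. In the second case the block is a singleton `{(i, j)}`, so that
the product has the single factor `sgn(f_j) x_i`. -/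
noncomputable def f₀Block (d : Params f g) (ℓ : Fin d.k) (x : Cube (Fin n)) : ℝ :=
  if 1 < (d.Z ℓ).card then
    (∏ i ∈ degTwo g (rows (d.Z ℓ)), (toReal (x i) - d.D i)) *
      ∏ j ∈ degTwo f (cols (d.Z ℓ)), d.φ j fun i => signed g x i
  else ∏ p ∈ d.Z ℓ, toReal (sgn (f p.2) * x p.1)

/-- The block function `g₀^(ℓ)`; for a singleton block `{(i, j)}` it is `sgn(g_i) y_j`. -/
noncomputable def g₀Block (d : Params f g) (ℓ : Fin d.k) (y : Cube (Fin m)) : ℝ :=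
  if 1 < (d.Z ℓ).card then
    (∏ j ∈ degTwo f (cols (d.Z ℓ)), (toReal (y j) - d.B j)) *
      ∏ i ∈ degTwo g (rows (d.Z ℓ)), d.γ i fun j => signed f y j
  else ∏ p ∈ d.Z ℓ, toReal (sgn (g p.1) * y p.2)

/-- The functions `f₀, …, f_m, g₀, …, g_n` are given by the parameters through the explicit
formulas. -/
structure Represents (d : Params f g) (f₀ : Cube (Fin n) → ℝ) (g₀ : Cube (Fin m) → ℝ) : Prop where
  f₀_eq : ∀ x, f₀ x = multilinearExt d.h fun ℓ => d.f₀Block ℓ x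
  g₀_eq : ∀ y, g₀ y = multilinearExt d.h fun ℓ => d.g₀Block ℓ y
  f_eq : ∀ j ∈ cols d.Z₀, ∀ x, f j x =
    (∏ i ∈ degTwo g (dep (f j)), (toReal (x i) + d.κ i j)) * d.φ j (fun i => x i) + d.B j
  g_eq : ∀ i ∈ rows d.Z₀, ∀ y, g i y =
    (∏ j ∈ degTwo f (dep (g i)), (toReal (y j) + d.κ i j)) * d.γ i (fun j => y j) + d.D i

end Params

end Polymorphisms

end GenPoly

open GenPoly

/-! Call a row or column heavy if its function has degree at least 2, and light if its function is ±
an input. Both sides of the polymorphism identity are affine in each entry, so the identity extends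
to real matrices Z; let F(Z) be the common value. By the chain rule, F depends on z_ij iff j ∈
Dep(g_i), and equally iff i ∈ Dep(f_j).

The rigidity comes from a relevant entry z = z_ij in a heavy row and a heavy column. With r the rest
of the row and c the rest of the column, g_i = s(r) + z u(r), f_j = t(c) + z v(c) and, the other
entries being fixed, F = p(c) + a(c) g_i = q(r) + b(r) f_j. The coefficient of z gives a(c) u(r) =
b(r) v(c), so a = w v and b = w u for a constant w; the remaining terms force s = K u + D and t = K
v + E with the same K (`exists_affine_of_separated`). Thus g_i - D and f_j - E are both divisible by
z + K. Hyperplanes belonging to different entries of a row or column meet, so D depends only on i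
and E only on j, and the product formulas for g_i and f_j follow.

Putting z_ij = -κ_ij shows that replacing g_i by D_i in F amounts to replacing f_j by B_j. Along a
connected component with several entries these restrictions all agree with one function Q free of
the entries of the component (`Params.exists_common_restriction`). Then F - Q is divisible by g_i -
D_i for each heavy row and by φ_j for each heavy column; these factors involve disjoint variables,
so F - Q is divisible by their product M_ℓ, and the quotient is again free of the component
(`Params.exists_affine_in_block`). For a single entry, M_ℓ is ± that entry and nothing is to be
shown. Being affine in each M_ℓ, F is a multilinear function h of M_1, …, M_k
(`exists_multilinearExt_comp_eq`).

Expanding the factors g_i - D_i makes M_ℓ symmetric in rows and columns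
(`Params.realBlock_rowVals_eq`). This proves the converse. In the direct part it gives f₀ and g₀
with the same h, because composition with non-constant functions of disjoint variables is injective.
-/

namespace GenPoly

/-! ### Multiaffine functions of real variables -/

section Multiaffine

variable {ι κ : Type*} [DecidableEq ι] [DecidableEq κ]

/-- A function of real variables is multiaffine if it is affine in each variable. -/
def IsMultiaffine (P : (ι → ℝ) → ℝ) : Prop :=
  ∀ (x : ι → ℝ) (i : ι) (t : ℝ), P (Function.update x i t) =
    P (Function.update x i 0) + t * (P (Function.update x i 1) - P (Function.update x i 0))

/-- The slope of a multiaffine function in the direction of the `i`-th variable. -/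
def slopeAt (P : (ι → ℝ) → ℝ) (i : ι) (x : ι → ℝ) : ℝ :=
  P (Function.update x i 1) - P (Function.update x i 0)

theorem IsMultiaffine.update_eq {P : (ι → ℝ) → ℝ} (hP : IsMultiaffine P) (x : ι → ℝ) (i : ι)
    (s t : ℝ) : P (Function.update x i t) =
      P (Function.update x i s) + (t - s) * slopeAt P i x := by
  rw [hP x i t, hP x i s, slopeAt]; ring

theorem IsMultiaffine.eq_update {P : (ι → ℝ) → ℝ} (hP : IsMultiaffine P) (x : ι → ℝ) (i : ι)
    (s : ℝ) : P x = P (Function.update x i s) + (x i - s) * slopeAt P i x := by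
  conv_lhs => rw [← Function.update_eq_self i x]
  exact hP.update_eq x i s (x i)

theorem isMultiaffine_const (c : ℝ) : IsMultiaffine (fun _ : ι → ℝ => c) := by
  intro x i t; ring

theorem IsMultiaffine.const_mul {P : (ι → ℝ) → ℝ} (hP : IsMultiaffine P) (c : ℝ) :
    IsMultiaffine fun x => c * P x := by
  intro x i t
  simp only [hP x i t]; ring

theorem IsMultiaffine.add {P Q : (ι → ℝ) → ℝ} (hP : IsMultiaffine P) (hQ : IsMultiaffine Q) :
    IsMultiaffine fun x => P x + Q x := by
  intro x i t
  simp only [hP x i t, hQ x i t]; ring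

theorem IsMultiaffine.sub {P Q : (ι → ℝ) → ℝ} (hP : IsMultiaffine P) (hQ : IsMultiaffine Q) :
    IsMultiaffine fun x => P x - Q x := by
  intro x i t
  simp only [hP x i t, hQ x i t]; ring

theorem isMultiaffine_sum {σ : Type*} (s : Finset σ) {P : σ → (ι → ℝ) → ℝ}
    (hP : ∀ a ∈ s, IsMultiaffine (P a)) : IsMultiaffine fun x => ∑ a ∈ s, P a x := by
  intro x i t
  rw [← Finset.sum_sub_distrib, Finset.mul_sum, ← Finset.sum_add_distrib]
  exact Finset.sum_congr rfl fun a ha => hP a ha x i t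

theorem isMultiaffine_prod_coord (s : Finset ι) : IsMultiaffine fun x : ι → ℝ => ∏ i ∈ s, x i := by
  intro x i t
  by_cases h : i ∈ s
  · simp only [Finset.prod_update_of_mem h]; ring
  · simp only [Finset.prod_update_of_notMem h]; ring

theorem IsMultiaffine.slope {P : (ι → ℝ) → ℝ} (hP : IsMultiaffine P) (i : ι) :
    IsMultiaffine (slopeAt P i) := by
  intro x k t
  unfold slopeAt
  by_cases h : k = i
  · subst h; simp
  · simp only [Function.update_comm h]
    rw [hP _ k t, hP (Function.update x i 0) k t]; ring

theorem slopeAt_update (P : (ι → ℝ) → ℝ) (i : ι) (x : ι → ℝ) (t : ℝ) :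
    slopeAt P i (Function.update x i t) = slopeAt P i x := by
  simp [slopeAt]

/-- Substituting multiaffine functions of disjoint sets of variables into a multiaffine function
yields a multiaffine function. -/
theorem IsMultiaffine.comp {H : (κ → ℝ) → ℝ} (hH : IsMultiaffine H) {P : κ → (ι → ℝ) → ℝ}
    (hP : ∀ a, IsMultiaffine (P a)) (S : κ → Set ι) (hS : ∀ a, DependsOn (P a) (S a))
    (hdisj : ∀ i a b, i ∈ S a → i ∈ S b → a = b) : IsMultiaffine fun x => H fun a => P a x := by
  have hconst : ∀ a i x s t, i ∉ S a →
      P a (Function.update x i s) = P a (Function.update x i t) := by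
    intro a i x s t hi
    refine hS a fun k hk => ?_
    have : k ≠ i := fun h => hi (h ▸ hk)
    simp [this]
  intro x i t
  by_cases h : ∃ a, i ∈ S a
  · obtain ⟨a, ha⟩ := h
    have key : ∀ s, H (fun b => P b (Function.update x i s)) =
        H (Function.update (fun b => P b (Function.update x i 0)) a
          (P a (Function.update x i s))) := by
      intro s
      congr 1
      funext b
      by_cases hb : b = a
      · subst hb; simp
      · rw [Function.update_of_ne hb]
        exact hconst b i x s 0 fun hi => hb (hdisj i b a hi ha)
    dsimp only
    rw [key t, key 1, hH _ a (P a (Function.update x i t)), hH _ a (P a (Function.update x i 1)),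
      key 0, hH _ a (P a (Function.update x i 0)), hP a x i t]
    ring
  · push Not at h
    have key : ∀ s, (fun b => P b (Function.update x i s)) =
        fun b => P b (Function.update x i 0) := by
      intro s
      funext b
      exact hconst b i x s 0 (h b)
    dsimp only
    rw [key t, key 1]; ring

theorem isMultiaffine_coord (i : ι) (c : ℝ) : IsMultiaffine fun x : ι → ℝ => c * x i := by
  have := (isMultiaffine_prod_coord {i}).const_mul c
  simpa using this

theorem isMultiaffine_prod {s : Finset κ} {P : κ → (ι → ℝ) → ℝ}
    (hP : ∀ a ∈ s, IsMultiaffine (P a)) (S : κ → Set ι) (hS : ∀ a ∈ s, DependsOn (P a) (S a))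
    (hdisj : ∀ i, ∀ a ∈ s, ∀ b ∈ s, i ∈ S a → i ∈ S b → a = b) :
    IsMultiaffine fun x => ∏ a ∈ s, P a x := by
  classical
  -- The product is a monomial with the `P a` substituted. Factors outside `s` are replaced by 0, so
  -- that nothing need be assumed about them.
  have := (isMultiaffine_prod_coord s).comp (P := fun a => if a ∈ s then P a else fun _ => 0)
    (fun a => by
      split_ifs with h
      · exact hP a h
      · exact isMultiaffine_const 0) (fun a => if a ∈ s then S a else ∅)
    (fun a => by
      split_ifs with h
      · exact hS a h
      · exact dependsOn_const 0)
    (fun i a b ha hb => by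
      split_ifs at ha hb with h h'
      · exact hdisj i a h b h' ha hb
      · exact hb.elim
      · exact ha.elim
      · exact ha.elim)
  intro x i t
  have h2 := this x i t
  have h3 : ∀ y : ι → ℝ, ∏ a ∈ s, (if a ∈ s then P a else fun _ => 0) y = ∏ a ∈ s, P a y :=
    fun y => Finset.prod_congr rfl fun a ha => by rw [if_pos ha]
  simpa only [h3] using h2

/-- The product of two multiaffine functions of disjoint sets of variables is multiaffine. -/
theorem IsMultiaffine.mul {P Q : (ι → ℝ) → ℝ} (hP : IsMultiaffine P) (hQ : IsMultiaffine Q)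
    {S T : Set ι} (hS : DependsOn P S) (hT : DependsOn Q T) (hdisj : ∀ i, i ∈ S → i ∉ T) :
    IsMultiaffine fun x => P x * Q x := by
  have := isMultiaffine_prod (s := Finset.univ) (P := fun b : Bool => if b then P else Q)
    (fun b _ => by cases b <;> simpa) (fun b => if b then S else T)
    (fun b _ => by cases b <;> simpa)
    (fun i a _ b _ ha hb => by
      cases a <;> cases b <;> simp at ha hb ⊢
      · exact hdisj i hb ha
      · exact hdisj i ha hb)
  simpa using this

theorem update_eq_of_dependsOn {P : (ι → ℝ) → ℝ} {S : Set ι} (h : DependsOn P S) {i : ι}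
    (hi : i ∉ S) (x : ι → ℝ) (t : ℝ) : P (Function.update x i t) = P x :=
  h fun k hk => Function.update_of_ne (show k ≠ i by rintro rfl; exact hi hk) _ _

variable [Fintype ι]

/-- A multiaffine function is determined by its values on a grid with two points in each
direction. -/
theorem IsMultiaffine.eq_of_grid {P Q : (ι → ℝ) → ℝ} (hP : IsMultiaffine P)
    (hQ : IsMultiaffine Q) {a b : ι → ℝ} (hab : ∀ i, a i ≠ b i)
    (h : ∀ x, (∀ i, x i = a i ∨ x i = b i) → P x = Q x) : P = Q := by
  -- The coordinates in `s` are released from the grid one at a time: an affine function of one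
  -- variable is determined by two values.
  have key : ∀ s : Finset ι, ∀ x, (∀ i ∉ s, x i = a i ∨ x i = b i) → P x = Q x := by
    intro s
    induction s using Finset.induction_on with
    | empty => exact fun x hx => h x fun i => hx i (by simp)
    | insert k s hk ih =>
      intro x hx
      have hmem : ∀ t, (t = a k ∨ t = b k) →
          P (Function.update x k t) = Q (Function.update x k t) := by
        intro t ht
        apply ih
        intro i hi
        by_cases hik : i = k
        · subst hik; simpa using ht
        · rw [Function.update_of_ne hik]
          exact hx i (by simp [hik, hi])
      have ha := hmem (a k) (Or.inl rfl)
      have hb := hmem (b k) (Or.inr rfl)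
      have h1 := hP.update_eq x k (a k) (b k)
      have h2 := hQ.update_eq x k (a k) (b k)
      have h3 : slopeAt P k x = slopeAt Q k x := by
        have : (b k - a k) * slopeAt P k x = (b k - a k) * slopeAt Q k x := by linarith
        exact mul_left_cancel₀ (sub_ne_zero.2 (hab k).symm) this
      rw [hP.eq_update x k (a k), hQ.eq_update x k (a k), ha, h3]
  funext x
  exact key Finset.univ x (by simp)

theorem dependsOn_of_update {P : (ι → ℝ) → ℝ} {S : Set ι}
    (h : ∀ i ∉ S, ∀ x t, P (Function.update x i t) = P x) : DependsOn P S := by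
  have key : ∀ s : Finset ι, ∀ x y : ι → ℝ, (∀ i ∉ s, x i = y i) → (∀ i ∈ S, x i = y i) →
      P x = P y := by
    intro s
    induction s using Finset.induction_on with
    | empty => exact fun x y hxy _ => congrArg P (funext fun i => hxy i (by simp))
    | insert k s hk ih =>
      intro x y hxy hS
      by_cases hkS : k ∈ S
      · exact ih x y (fun i hi => by
          by_cases hik : i = k
          · exact hik ▸ hS k hkS
          · exact hxy i (by simp [hik, hi])) hS
      · rw [← h k hkS x (y k)]
        refine ih _ y (fun i hi => ?_) fun i hi => ?_
        · by_cases hik : i = k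
          · subst hik; simp
          · rw [Function.update_of_ne hik]
            exact hxy i (by simp [hik, hi])
        · rw [Function.update_of_ne (show i ≠ k by rintro rfl; exact hkS hi)]
          exact hS i hi
  exact fun x y hxy => key Finset.univ x y (by simp) hxy

theorem IsMultiaffine.dependsOn {P : (ι → ℝ) → ℝ} (hP : IsMultiaffine P) {S : Set ι}
    (h : ∀ i ∉ S, ∀ x, slopeAt P i x = 0) : DependsOn P S :=
  dependsOn_of_update fun i hi x t => by
    rw [hP.eq_update x i t, h i hi x]; ring

end Multiaffine

/-! ### Functions on the cube: relevance, degree and signed inputs -/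

section Cube

theorem toReal_update {ι : Type*} [DecidableEq ι] (x : Cube ι) (i : ι) (s : ℤˣ) :
    (fun k => toReal (Function.update x i s k)) =
      Function.update (fun k => toReal (x k)) i (toReal s) := by
  funext k
  by_cases h : k = i
  · subst h; simp
  · simp [h]

variable {ι : Type*} [Fintype ι] [DecidableEq ι]

theorem toReal_mul (s t : ℤˣ) : toReal (s * t) = toReal s * toReal t := by simp [toReal]

theorem toReal_mul_self (s : ℤˣ) : toReal s * toReal s = 1 := by
  rw [← toReal_mul, Int.units_mul_self]; simp [toReal]

@[simp] theorem toReal_one : toReal 1 = 1 := by simp [toReal]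

@[simp] theorem toReal_neg (s : ℤˣ) : toReal (-s) = -toReal s := by simp [toReal]

theorem toReal_ne_zero (s : ℤˣ) : toReal s ≠ 0 := by simp [toReal]

theorem isMultiaffine_multilinearExt (f : Cube ι → ℝ) : IsMultiaffine (multilinearExt f) :=
  isMultiaffine_sum _ fun S _ => (isMultiaffine_prod_coord S).const_mul _

theorem IsMultiaffine.eq_of_cube {P Q : (ι → ℝ) → ℝ} (hP : IsMultiaffine P)
    (hQ : IsMultiaffine Q)
    (h : ∀ x : Cube ι, P (fun i => toReal (x i)) = Q fun i => toReal (x i)) : P = Q := by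
  refine hP.eq_of_grid hQ (a := fun _ => 1) (b := fun _ => -1) (fun i => by norm_num) ?_
  intro x hx
  have : x = fun i => toReal (if x i = 1 then 1 else -1) := by
    funext i
    rcases hx i with h | h <;> norm_num [h]
  rw [this]
  exact h _

/-- A multiaffine function is the multilinear extension of its restriction to the cube. -/
theorem IsMultiaffine.multilinearExt_eq {P : (ι → ℝ) → ℝ} (hP : IsMultiaffine P) {f : Cube ι → ℝ}
    (h : ∀ x : Cube ι, f x = P fun i => toReal (x i)) : multilinearExt f = P :=
  (isMultiaffine_multilinearExt f).eq_of_cube hP fun x => by rw [multilinearExt_toReal, h]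

theorem mem_dep {f : Cube ι → ℝ} {i : ι} :
    i ∈ dep f ↔ ∃ x : Cube ι, f (Function.update x i 1) ≠ f (Function.update x i (-1)) := by
  simp [dep]

theorem exists_slopeAt_ne_zero {f : Cube ι → ℝ} {i : ι} (h : i ∈ dep f) :
    ∃ x, slopeAt (multilinearExt f) i x ≠ 0 := by
  obtain ⟨x, hx⟩ := mem_dep.1 h
  refine ⟨fun k => toReal (x k), fun h0 => hx ?_⟩
  rw [← multilinearExt_toReal f, ← multilinearExt_toReal f, toReal_update, toReal_update,
    (isMultiaffine_multilinearExt f).update_eq _ i (toReal (-1)) (toReal 1), h0]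
  ring

theorem slopeAt_eq_zero_of_notMem_dep {f : Cube ι → ℝ} {i : ι} (h : i ∉ dep f) (x : ι → ℝ) :
    slopeAt (multilinearExt f) i x = 0 := by
  have hP := isMultiaffine_multilinearExt f
  have := (hP.slope i).eq_of_cube (isMultiaffine_const 0) fun x => by
    have h1 : f (Function.update x i 1) = f (Function.update x i (-1)) := by
      by_contra h2; exact h (mem_dep.2 ⟨x, h2⟩)
    rw [← multilinearExt_toReal f, ← multilinearExt_toReal f, toReal_update, toReal_update,
      hP.update_eq _ i (toReal (-1)) (toReal 1)] at h1
    simp only [toReal_neg, toReal_one] at h1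
    linarith
  exact congrFun this x

/-- Relevance is defined by flips on the cube; this form tests it at arbitrary real points, as
needed for compositions whose inner functions have real values. -/
theorem mem_dep_iff_slopeAt {f : Cube ι → ℝ} {i : ι} :
    i ∈ dep f ↔ ∃ x, slopeAt (multilinearExt f) i x ≠ 0 :=
  ⟨exists_slopeAt_ne_zero, fun ⟨x, hx⟩ => by
    by_contra h; exact hx (slopeAt_eq_zero_of_notMem_dep h x)⟩

theorem dependsOn_multilinearExt (f : Cube ι → ℝ) :
    DependsOn (multilinearExt f) (dep f : Set ι) :=
  (isMultiaffine_multilinearExt f).dependsOn fun i hi x =>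
    slopeAt_eq_zero_of_notMem_dep (by simpa using hi) x

theorem apply_eq_of_dep (f : Cube ι → ℝ) {x y : Cube ι} (h : ∀ i ∈ dep f, x i = y i) :
    f x = f y := by
  rw [← multilinearExt_toReal f, ← multilinearExt_toReal f]
  exact dependsOn_multilinearExt f fun i hi => by rw [h i (by simpa using hi)]

theorem NonConstant.dep_nonempty {f : Cube ι → ℝ} (h : NonConstant f) : (dep f).Nonempty := by
  obtain ⟨x, y, hxy⟩ := h
  by_contra h0
  rw [Finset.not_nonempty_iff_eq_empty] at h0
  exact hxy (apply_eq_of_dep f (by simp [h0]))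

/-- The terms of the sum cancel in pairs under flipping the coordinate `k`. -/
theorem fourierCoeff_eq_zero_of_flip {f : Cube ι → ℝ} {S : Finset ι} (k : ι)
    (h : ∀ x, f (Function.update x k (-(x k))) * ∏ i ∈ S, toReal (Function.update x k (-(x k)) i) =
      -(f x * ∏ i ∈ S, toReal (x i))) : fourierCoeff f S = 0 := by
  unfold fourierCoeff
  have : ∑ x : Cube ι, f x * ∏ i ∈ S, toReal (x i) = 0 := by
    refine Finset.sum_involution (fun x _ => Function.update x k (-(x k))) ?_ ?_ ?_ ?_
    · intro x _
      rw [h]; ring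
    · intro x _ _ he
      have := congrFun he k
      simp at this
    · simp
    · intro x _
      simp
  rw [this, zero_div]

theorem prod_toReal_update_neg {ι : Type*} [DecidableEq ι] (x : Cube ι) (k : ι) (S : Finset ι) :
    ∏ i ∈ S, toReal (Function.update x k (-(x k)) i) =
      (if k ∈ S then -1 else 1) * ∏ i ∈ S, toReal (x i) := by
  have h := congrArg (fun v : ι → ℝ => ∏ i ∈ S, v i) (toReal_update x k (-(x k)))
  rw [show ∏ i ∈ S, toReal (Function.update x k (-(x k)) i) = _ from h]
  split_ifs with hk
  · rw [Finset.prod_update_of_mem hk, ← Finset.mul_prod_erase S _ hk, Finset.sdiff_singleton_eq_erase]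
    simp
  · rw [Finset.prod_update_of_notMem hk]; simp

theorem fourierCoeff_eq_zero_of_indep {f : Cube ι → ℝ} {S : Finset ι} {k : ι} (hk : k ∈ S)
    (h : ∀ x s, f (Function.update x k s) = f x) : fourierCoeff f S = 0 :=
  fourierCoeff_eq_zero_of_flip k fun x => by
    rw [h, prod_toReal_update_neg, if_pos hk]; ring

theorem fourierCoeff_add (f g : Cube ι → ℝ) (S : Finset ι) :
    fourierCoeff (fun x => f x + g x) S = fourierCoeff f S + fourierCoeff g S := by
  simp only [fourierCoeff, add_mul, Finset.sum_add_distrib, add_div]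

theorem mem_fourierSupport {f : Cube ι → ℝ} {S : Finset ι} :
    S ∈ fourierSupport f ↔ fourierCoeff f S ≠ 0 := by
  simp [fourierSupport]

theorem subset_dep_of_mem_fourierSupport {f : Cube ι → ℝ} {S : Finset ι}
    (h : S ∈ fourierSupport f) : S ⊆ dep f := by
  intro k hk
  by_contra hd
  refine mem_fourierSupport.1 h (fourierCoeff_eq_zero_of_indep hk fun x s => ?_)
  refine apply_eq_of_dep f fun i hi => ?_
  exact Function.update_of_ne (show i ≠ k by rintro rfl; exact hd hi) _ _

theorem deg_le_card_dep (f : Cube ι → ℝ) : deg f ≤ (dep f).card :=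
  Finset.sup_le fun _ hS => Finset.card_le_card (subset_dep_of_mem_fourierSupport hS)

theorem NonConstant.one_le_deg {f : Cube ι → ℝ} (h : NonConstant f) : 1 ≤ deg f := by
  by_contra h0
  obtain ⟨x, y, hxy⟩ := h
  have : ∀ S ∈ fourierSupport f, S = ∅ := by
    intro S hS
    have : S.card ≤ deg f := Finset.le_sup (f := Finset.card) hS
    exact Finset.card_eq_zero.1 (by omega)
  have hc : ∀ z, f z = fourierCoeff f ∅ := by
    intro z
    rw [← multilinearExt_toReal f z, multilinearExt, Finset.sum_eq_single ∅]
    · simp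
    · intro S _ hS
      have : fourierCoeff f S = 0 := by
        by_contra h1; exact hS (this S (mem_fourierSupport.2 h1))
      rw [this, zero_mul]
    · simp
  exact hxy (by rw [hc x, hc y])

theorem IsSignedInput.exists_sgn {f : Cube ι → ℝ} (h : IsSignedInput f) :
    ∃ i, ∀ x, f x = toReal (sgn f * x i) := by
  classical
  obtain ⟨s, i, hs⟩ := h
  unfold sgn
  split_ifs with h0
  · obtain ⟨j, hj⟩ := h0
    exact ⟨j, by simpa using hj⟩
  · rcases Int.units_eq_one_or s with h | h
    · exact ⟨i, by simpa [h] using hs⟩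
    · exact absurd ⟨i, by simpa [h] using hs⟩ h0

theorem dep_of_eq_mul {f : Cube ι → ℝ} {s : ℤˣ} {i : ι} (h : ∀ x, f x = toReal (s * x i)) :
    dep f = {i} := by
  ext k
  rw [mem_dep, Finset.mem_singleton]
  constructor
  · rintro ⟨x, hx⟩
    by_contra hk
    apply hx
    rw [h, h, Function.update_of_ne (Ne.symm hk), Function.update_of_ne (Ne.symm hk)]
  · rintro rfl
    refine ⟨1, fun h1 => ?_⟩
    rw [h, h] at h1
    simp only [Function.update_self, toReal_mul, toReal_neg, toReal_one] at h1
    have := toReal_ne_zero s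
    apply this; linarith

theorem IsSignedInput.deg_eq_one {f : Cube ι → ℝ} (h : IsSignedInput f) : deg f = 1 := by
  obtain ⟨i, hi⟩ := h.exists_sgn
  have hd := dep_of_eq_mul hi
  apply le_antisymm
  · simpa [hd] using deg_le_card_dep f
  · refine NonConstant.one_le_deg ?_
    obtain ⟨x, hx⟩ := mem_dep.1 (show i ∈ dep f by simp [hd])
    exact ⟨_, _, hx⟩

/-- For a function of the form `± x_j` on which the coordinate `i` is relevant. -/
theorem IsSignedInput.multilinearExt_eq {f : Cube ι → ℝ} (h : IsSignedInput f) {i : ι}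
    (hi : i ∈ dep f) (x : ι → ℝ) : multilinearExt f x = toReal (sgn f) * x i := by
  obtain ⟨j, hj⟩ := h.exists_sgn
  rw [dep_of_eq_mul hj, Finset.mem_singleton] at hi
  subst hi
  rw [(isMultiaffine_coord i (toReal (sgn f))).multilinearExt_eq]
  intro x
  rw [hj, toReal_mul]

theorem IsSignedInput.dep_eq {f : Cube ι → ℝ} (h : IsSignedInput f) {i : ι}
    (hi : i ∈ dep f) : dep f = {i} := by
  obtain ⟨j, hj⟩ := h.exists_sgn
  have := dep_of_eq_mul hj
  rw [this, Finset.mem_singleton] at hi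
  rw [this, hi]

theorem IsBooleanLike.isSignedInput_or {f : Cube ι → ℝ} (h : IsBooleanLike f)
    (hc : NonConstant f) : IsSignedInput f ∨ 2 ≤ deg f := by
  rcases Nat.lt_or_ge (deg f) 2 with h2 | h2
  · have := hc.one_le_deg
    exact Or.inl (h.2.1 (by omega))
  · exact Or.inr h2

/-- If a relevant coordinate of `f` lies in a monomial of degree at least `2`, then the slope of `f`
in this direction is not constant. -/
theorem slopeAt_nonconstant {f : Cube ι → ℝ} {i : ι} {S : Finset ι} (hS : S ∈ fourierSupport f)
    (hcard : 2 ≤ S.card) (hi : i ∈ S) :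
    ∃ x y, slopeAt (multilinearExt f) i x ≠ slopeAt (multilinearExt f) i y := by
  by_contra! hconst
  obtain ⟨k, hk, hki⟩ := Finset.exists_mem_ne (by omega : 1 < S.card) i
  set u := slopeAt (multilinearExt f) i 0 with hu
  have hP := isMultiaffine_multilinearExt f
  -- With constant slope `u`, f is a function free of x_i plus u x_i. The first summand has no
  -- coefficient at `S` because `i ∈ S`, the second none because `S` also contains `k ≠ i`.
  have hf : f = fun x => (f (Function.update x i 1) - u) + toReal (x i) * u := by
    funext x
    have h1 := hP.eq_update (fun k => toReal (x k)) i (toReal 1)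
    rw [← toReal_update, multilinearExt_toReal, multilinearExt_toReal, hconst _ 0, ← hu] at h1
    rw [h1]; simp only [toReal_one]; ring
  refine mem_fourierSupport.1 hS ?_
  rw [hf, fourierCoeff_add, fourierCoeff_eq_zero_of_indep hi, fourierCoeff_eq_zero_of_indep hk,
    add_zero]
  · intro x s
    rw [Function.update_of_ne hki.symm]
  · intro x s
    simp

/-- This is the only use of clause (b) of the Boolean-like property. It supplies the non-constant u
and v required by the separation argument. -/
theorem IsBooleanLike.slopeAt_nonconstant {f : Cube ι → ℝ} (h : IsBooleanLike f)
    (h2 : 2 ≤ deg f) {i : ι} (hi : i ∈ dep f) :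
    ∃ x y, slopeAt (multilinearExt f) i x ≠ slopeAt (multilinearExt f) i y := by
  have hd : ¬ IsDictator f := fun hd => by
    have := h.1.1.2 hd; omega
  obtain ⟨S, hS, hc, hw⟩ := h.1.2 hd i hi
  exact GenPoly.slopeAt_nonconstant hS hc hw

end Cube

end GenPoly

namespace GenPoly

/-! ### Block functions, their symmetry in rows and columns, and the converse -/

section Blocks

variable {n m : ℕ} {f : Fin m → Cube (Fin n) → ℝ} {g : Fin n → Cube (Fin m) → ℝ}

theorem mem_rows {W : Finset (Fin n × Fin m)} {i : Fin n} : i ∈ rows W ↔ ∃ j, (i, j) ∈ W := by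
  simp [rows]

theorem mem_cols {W : Finset (Fin n × Fin m)} {j : Fin m} : j ∈ cols W ↔ ∃ i, (i, j) ∈ W := by
  simp [cols]

theorem mem_degOne {α β : Type*} [Fintype β] [DecidableEq β] {v : α → Cube β → ℝ} {I : Finset α}
    {a : α} : a ∈ degOne v I ↔ a ∈ I ∧ deg (v a) = 1 := by simp [degOne]

theorem mem_degTwo {α β : Type*} [Fintype β] [DecidableEq β] {v : α → Cube β → ℝ} {I : Finset α}
    {a : α} : a ∈ degTwo v I ↔ a ∈ I ∧ 2 ≤ deg (v a) := by simp [degTwo]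

/-- The real version of `signed`. -/
noncomputable def realSigned {α β : Type*} [Fintype β] [DecidableEq β]
    (v : α → Cube β → ℝ) (x : α → ℝ) : α → ℝ :=
  fun a => if deg (v a) = 1 then toReal (sgn (v a)) * x a else x a

theorem realSigned_eq {α β : Type*} [Fintype β] [DecidableEq β] (v : α → Cube β → ℝ) (x : α → ℝ)
    (a : α) : realSigned v x a = (if deg (v a) = 1 then toReal (sgn (v a)) else 1) * x a := by
  unfold realSigned; split_ifs <;> simp

theorem realSigned_toReal {α β : Type*} [Fintype β] [DecidableEq β] (v : α → Cube β → ℝ)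
    (x : Cube α) (a : α) : realSigned v (fun a => toReal (x a)) a = toReal (signed v x a) := by
  unfold realSigned signed; split_ifs <;> simp [toReal_mul]

/-- The values of `g_1, …, g_n` on the rows of a real matrix. -/
noncomputable def rowVals (g : Fin n → Cube (Fin m) → ℝ) (Z : Fin n × Fin m → ℝ) : Fin n → ℝ :=
  fun i => multilinearExt (g i) fun j => Z (i, j)

/-- The values of `f_1, …, f_m` on the columns of a real matrix. -/
noncomputable def colVals (f : Fin m → Cube (Fin n) → ℝ) (Z : Fin n × Fin m → ℝ) : Fin m → ℝ :=
  fun j => multilinearExt (f j) fun i => Z (i, j)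

theorem rowVals_swap (f : Fin m → Cube (Fin n) → ℝ) (Z : Fin n × Fin m → ℝ) :
    rowVals f (fun p => Z p.swap) = colVals f Z := rfl

namespace Params

/-- Interchanging the roles of rows and columns. -/
abbrev swap (d : Params f g) : Params g f where
  Z₀ := d.Z₀.image Prod.swap
  k := d.k
  Z ℓ := (d.Z ℓ).image Prod.swap
  h := d.h
  φ := d.γ
  γ := d.φ
  B := d.D
  D := d.B
  κ i j := d.κ j i

theorem rows_image_swap (W : Finset (Fin n × Fin m)) : rows (W.image Prod.swap) = cols W := by
  ext; simp [mem_rows, mem_cols]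

theorem cols_image_swap (W : Finset (Fin n × Fin m)) : cols (W.image Prod.swap) = rows W := by
  ext; simp [mem_rows, mem_cols]

theorem rows_swap (d : Params f g) (ℓ : Fin d.k) : rows (d.swap.Z ℓ) = cols (d.Z ℓ) :=
  rows_image_swap _

theorem cols_swap (d : Params f g) (ℓ : Fin d.k) : cols (d.swap.Z ℓ) = rows (d.Z ℓ) :=
  cols_image_swap _

theorem IsBlockPartition.swap {d : Params f g} (hd : d.IsBlockPartition) :
    d.swap.IsBlockPartition where
  nonempty ℓ := (hd.nonempty ℓ).image _
  union := by
    change d.Z₀.image Prod.swap = Finset.univ.biUnion fun ℓ => (d.Z ℓ).image Prod.swap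
    rw [hd.union, Finset.biUnion_image]
  rows_disjoint ℓ ℓ' h := by rw [rows_swap, rows_swap]; exact hd.cols_disjoint ℓ ℓ' h
  cols_disjoint ℓ ℓ' h := by rw [cols_swap, cols_swap]; exact hd.rows_disjoint ℓ ℓ' h
  dep_row ℓ i hi := by rw [cols_swap]; rw [rows_swap] at hi; exact hd.dep_col ℓ i hi
  dep_col ℓ i hi := by rw [rows_swap]; rw [cols_swap] at hi; exact hd.dep_row ℓ i hi
  dep_iff ℓ i hi j hj := by
    rw [rows_swap] at hi; rw [cols_swap] at hj; exact (hd.dep_iff ℓ j hj i hi).symm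

theorem IsBlockPartition.mem_Z₀ {d : Params f g} (hd : d.IsBlockPartition)
    {p : Fin n × Fin m} : p ∈ d.Z₀ ↔ ∃ ℓ, p ∈ d.Z ℓ := by
  rw [hd.union]; simp

theorem IsBlockPartition.rows_subset {d : Params f g} (hd : d.IsBlockPartition) {ℓ : Fin d.k}
    {i : Fin n} (hi : i ∈ rows (d.Z ℓ)) : i ∈ rows d.Z₀ := by
  obtain ⟨j, hj⟩ := mem_rows.1 hi
  exact mem_rows.2 ⟨j, hd.mem_Z₀.2 ⟨ℓ, hj⟩⟩

/-- The multilinear extension of the block function `f₀^(ℓ)`. -/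
noncomputable def realBlock (d : Params f g) (ℓ : Fin d.k) (x : Fin n → ℝ) : ℝ :=
  if 1 < (d.Z ℓ).card then
    (∏ i ∈ degTwo g (rows (d.Z ℓ)), (x i - d.D i)) *
      ∏ j ∈ degTwo f (cols (d.Z ℓ)), multilinearExt (d.φ j) fun i => realSigned g x i
  else ∏ p ∈ d.Z ℓ, toReal (sgn (f p.2)) * x p.1

theorem realBlock_toReal (d : Params f g) (ℓ : Fin d.k) (x : Cube (Fin n)) :
    d.realBlock ℓ (fun i => toReal (x i)) = d.f₀Block ℓ x := by
  simp only [realBlock, f₀Block, realSigned_toReal, multilinearExt_toReal, toReal_mul]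

theorem realBlock_swap_toReal (d : Params f g) (ℓ : Fin d.k) (y : Cube (Fin m)) :
    d.swap.realBlock ℓ (fun j => toReal (y j)) = d.g₀Block ℓ y := by
  rw [realBlock_toReal, f₀Block, g₀Block, rows_swap, cols_swap]
  have h1 : (d.swap.Z ℓ).card = (d.Z ℓ).card := Finset.card_image_of_injective _ Prod.swap_injective
  have h2 : ∏ p ∈ d.swap.Z ℓ, toReal (sgn (g p.2) * y p.1) =
      ∏ p ∈ d.Z ℓ, toReal (sgn (g p.1) * y p.2) :=
    Finset.prod_image fun _ _ _ _ h => Prod.swap_injective h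
  rw [h1, h2]

theorem multilinearExt_φ_dependsOn (d : Params f g) (j : Fin m) :
    DependsOn (fun x : Fin n → ℝ => multilinearExt (d.φ j) fun i => realSigned g x i)
      (degOne g (dep (f j)) : Set (Fin n)) := by
  intro x y hxy
  dsimp only
  congr 1
  funext i
  rw [realSigned_eq, realSigned_eq, hxy i i.2]

theorem dependsOn_realBlock {d : Params f g} (hd : d.IsBlockPartition) (ℓ : Fin d.k) :
    DependsOn (d.realBlock ℓ) (rows (d.Z ℓ) : Set (Fin n)) := by
  intro x y hxy
  unfold realBlock
  split_ifs with h
  · congr 1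
    · exact Finset.prod_congr rfl fun i hi => by rw [hxy i (mem_degTwo.1 hi).1]
    · refine Finset.prod_congr rfl fun j hj => ?_
      exact d.multilinearExt_φ_dependsOn j fun i hi =>
        hxy i (hd.dep_col ℓ j (mem_degTwo.1 hj).1 (mem_degOne.1 hi).1)
  · exact Finset.prod_congr rfl fun p hp => by rw [hxy p.1 (mem_rows.2 ⟨p.2, hp⟩)]

theorem isSignedInput_of_deg_eq_one {f : Cube (Fin n) → ℝ} (h : IsSignedInput f ∨ 2 ≤ deg f)
    (h1 : deg f = 1) : IsSignedInput f :=
  h.resolve_right (by omega)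

theorem isMultiaffine_multilinearExt_comp {ι : Type*} [DecidableEq ι] {s : Finset ι}
    (φ : Cube s → ℝ) (c : ι → ℝ) :
    IsMultiaffine fun x : ι → ℝ => multilinearExt φ fun i => c i * x i := by
  refine (isMultiaffine_multilinearExt φ).comp (P := fun (i : s) (x : ι → ℝ) => c i * x i)
    (fun i => isMultiaffine_coord _ _) (fun i => ({i.1} : Set ι)) (fun i x y hxy => ?_) ?_
  · exact congrArg (c i * ·) (hxy i.1 rfl)
  · rintro i a b rfl hb
    exact Subtype.ext hb

theorem isMultiaffine_φ (d : Params f g) (j : Fin m) :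
    IsMultiaffine fun x : Fin n → ℝ => multilinearExt (d.φ j) fun i => realSigned g x i := by
  simp only [realSigned_eq]
  exact isMultiaffine_multilinearExt_comp (d.φ j) fun i =>
    if deg (g i) = 1 then toReal (sgn (g i)) else 1

theorem isMultiaffine_coord_add (i : Fin n) (c : ℝ) :
    IsMultiaffine fun x : Fin n → ℝ => x i + c := by
  simpa using (isMultiaffine_coord i 1).add (isMultiaffine_const c)

theorem isMultiaffine_prod_coord_add (s : Finset (Fin n)) (c : Fin n → ℝ) :
    IsMultiaffine fun x : Fin n → ℝ => ∏ i ∈ s, (x i + c i) :=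
  isMultiaffine_prod (fun i _ => isMultiaffine_coord_add i (c i)) (fun i => {i})
    (fun i _ x y hxy => by rw [hxy i rfl]) (by rintro i a _ b _ rfl hb; exact hb)

theorem IsBlockPartition.dep_eq_of_deg_eq_one {d : Params f g} (hd : d.IsBlockPartition)
    (hg : ∀ i ∈ rows d.Z₀, IsSignedInput (g i) ∨ 2 ≤ deg (g i)) {ℓ : Fin d.k} {i : Fin n}
    {j : Fin m} (hj : j ∈ cols (d.Z ℓ)) (hi : i ∈ degOne g (dep (f j))) :
    IsSignedInput (g i) ∧ j ∈ dep (g i) := by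
  rw [mem_degOne] at hi
  have hir := hd.dep_col ℓ j hj hi.1
  exact ⟨isSignedInput_of_deg_eq_one (hg i (hd.rows_subset hir)) hi.2,
    (hd.dep_iff ℓ i hir j hj).2 hi.1⟩

/-- No variable occurs in two factors: the linear factors use heavy rows and the φ_j use light ones,
and a light row i lies in Dep(f_j) for a single column j of the block, because g_i = ± y_j. -/
theorem isMultiaffine_realBlock {d : Params f g} (hd : d.IsBlockPartition)
    (hg : ∀ i ∈ rows d.Z₀, IsSignedInput (g i) ∨ 2 ≤ deg (g i)) (ℓ : Fin d.k) :
    IsMultiaffine (d.realBlock ℓ) := by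
  unfold realBlock
  split_ifs with h
  · refine IsMultiaffine.mul (S := {i | 2 ≤ deg (g i)}) (T := {i | deg (g i) = 1}) ?_ ?_ ?_ ?_ ?_
    · simpa only [sub_eq_add_neg] using isMultiaffine_prod_coord_add _ fun i => -d.D i
    · refine isMultiaffine_prod (fun j _ => d.isMultiaffine_φ j) _
        (fun j _ => d.multilinearExt_φ_dependsOn j) ?_
      intro i a ha b hb hia hib
      obtain ⟨h1, h2⟩ := hd.dep_eq_of_deg_eq_one hg (mem_degTwo.1 ha).1 hia
      obtain ⟨-, h3⟩ := hd.dep_eq_of_deg_eq_one hg (mem_degTwo.1 hb).1 hib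
      rw [h1.dep_eq h2, Finset.mem_singleton] at h3
      exact h3.symm
    · intro x y hxy
      exact Finset.prod_congr rfl fun i hi => by rw [hxy i (mem_degTwo.1 hi).2]
    · intro x y hxy
      exact Finset.prod_congr rfl fun j hj =>
        d.multilinearExt_φ_dependsOn j fun i hi => hxy i (mem_degOne.1 hi).2
    · intro i h1 h2
      simp only [Set.mem_ofPred_eq] at h1 h2
      omega
  · obtain ⟨p, hp⟩ := Finset.card_eq_one.1
      (le_antisymm (not_lt.1 h) (Finset.card_pos.2 (hd.nonempty ℓ)))
    simp only [hp, Finset.prod_singleton]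
    exact isMultiaffine_coord _ _

/-- The formula for `g_i`, extended to real points. -/
theorem multilinearExt_g_eq {d : Params f g} {i : Fin n}
    (hi : ∀ y, g i y = (∏ j ∈ degTwo f (dep (g i)), (toReal (y j) + d.κ i j)) *
      d.γ i (fun j => y j) + d.D i) (y : Fin m → ℝ) :
    multilinearExt (g i) y = (∏ j ∈ degTwo f (dep (g i)), (y j + d.κ i j)) *
      multilinearExt (d.γ i) (fun j => y j) + d.D i := by
  have hP : IsMultiaffine fun y : Fin m → ℝ => (∏ j ∈ degTwo f (dep (g i)), (y j + d.κ i j)) *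
      multilinearExt (d.γ i) (fun j => y j) + d.D i := by
    refine IsMultiaffine.add (IsMultiaffine.mul (S := {j | 2 ≤ deg (f j)})
      (T := {j | deg (f j) = 1}) (isMultiaffine_prod_coord_add _ fun j => d.κ i j) ?_ ?_ ?_ ?_)
      (isMultiaffine_const _)
    · simpa using isMultiaffine_multilinearExt_comp (d.γ i) 1
    · intro x y hxy
      exact Finset.prod_congr rfl fun i hi => by rw [hxy i (mem_degTwo.1 hi).2]
    · intro x y hxy
      dsimp only
      congr 1
      funext j
      exact hxy j (mem_degOne.1 j.2).2
    · intro i h1 h2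
      simp only [Set.mem_ofPred_eq] at h1 h2
      omega
  rw [hP.multilinearExt_eq]
  intro x
  rw [hi, multilinearExt_toReal (d.γ i) fun j => x j]

/-- This is the purpose of the vector x^sgn: for a light row the value is sgn(g_i) z_ij, and
multiplying by the sign once more recovers the entry itself. -/
theorem realSigned_rowVals {d : Params f g} (hd : d.IsBlockPartition)
    (hg : ∀ i ∈ rows d.Z₀, IsSignedInput (g i) ∨ 2 ≤ deg (g i)) {ℓ : Fin d.k} {i : Fin n}
    {j : Fin m} (hj : j ∈ cols (d.Z ℓ)) (hi : i ∈ degOne g (dep (f j)))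
    (Z : Fin n × Fin m → ℝ) : realSigned g (rowVals g Z) i = Z (i, j) := by
  obtain ⟨h1, h2⟩ := hd.dep_eq_of_deg_eq_one hg hj hi
  rw [realSigned, if_pos (mem_degOne.1 hi).2, rowVals, h1.multilinearExt_eq h2, ← mul_assoc,
    toReal_mul_self, one_mul]

/-- The block function composed with the functions `g_i` as a product of functions of disjoint
sets of entries. -/
theorem realBlock_rowVals {d : Params f g} (hd : d.IsBlockPartition)
    (hg : ∀ i ∈ rows d.Z₀, IsSignedInput (g i) ∨ 2 ≤ deg (g i)) {ℓ : Fin d.k}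
    (hℓ : 1 < (d.Z ℓ).card) (Z : Fin n × Fin m → ℝ) :
    d.realBlock ℓ (rowVals g Z) = (∏ i ∈ degTwo g (rows (d.Z ℓ)), (rowVals g Z i - d.D i)) *
      ∏ j ∈ degTwo f (cols (d.Z ℓ)), multilinearExt (d.φ j) fun i => Z (i, j) := by
  rw [realBlock, if_pos hℓ]
  congr 1
  refine Finset.prod_congr rfl fun j hj => ?_
  congr 1
  funext i
  exact realSigned_rowVals hd hg (mem_degTwo.1 hj).1 i.2 Z

/-- Inserting the formulas for the g_i leaves linear factors in the entries, the γ_i and the φ_j, an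
expression in which rows and columns play the same role. -/
theorem realBlock_rowVals_eq_prod {d : Params f g} (hd : d.IsBlockPartition)
    (hg : ∀ i ∈ rows d.Z₀, IsSignedInput (g i) ∨ 2 ≤ deg (g i))
    (hgeq : ∀ i ∈ rows d.Z₀, ∀ y, g i y =
      (∏ j ∈ degTwo f (dep (g i)), (toReal (y j) + d.κ i j)) * d.γ i (fun j => y j) + d.D i)
    {ℓ : Fin d.k} (hℓ : 1 < (d.Z ℓ).card) (Z : Fin n × Fin m → ℝ) :
    d.realBlock ℓ (rowVals g Z) =
      (∏ i ∈ degTwo g (rows (d.Z ℓ)), ∏ j ∈ degTwo f (dep (g i)), (Z (i, j) + d.κ i j)) *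
      ((∏ i ∈ degTwo g (rows (d.Z ℓ)), multilinearExt (d.γ i) fun j => Z (i, j)) *
      ∏ j ∈ degTwo f (cols (d.Z ℓ)), multilinearExt (d.φ j) fun i => Z (i, j)) := by
  rw [realBlock_rowVals hd hg hℓ, ← mul_assoc, ← Finset.prod_mul_distrib]
  congr 1
  refine Finset.prod_congr rfl fun i hi => ?_
  rw [rowVals, multilinearExt_g_eq (hgeq i (hd.rows_subset (mem_degTwo.1 hi).1))]
  ring

/-- At most one variable is relevant in the row, so the degree is at most 1 and only the signed
input remains. -/
theorem IsBlockPartition.multilinearExt_of_singleton {d : Params f g} (hd : d.IsBlockPartition)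
    (hg : ∀ i ∈ rows d.Z₀, IsSignedInput (g i) ∨ 2 ≤ deg (g i)) {ℓ : Fin d.k}
    {i : Fin n} {j : Fin m} (h : d.Z ℓ = {(i, j)}) (y : Fin m → ℝ) :
    multilinearExt (g i) y = toReal (sgn (g i)) * y j := by
  have hi : i ∈ rows (d.Z ℓ) := mem_rows.2 ⟨j, by simp [h]⟩
  have hsub : dep (g i) ⊆ {j} := by
    have := hd.dep_row ℓ i hi
    rw [h] at this
    simpa [cols] using this
  have hdeg : deg (g i) ≤ 1 := (deg_le_card_dep _).trans (by simpa using Finset.card_le_card hsub)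
  have hs : IsSignedInput (g i) := (hg i (hd.rows_subset hi)).resolve_right (by omega)
  obtain ⟨k, hk⟩ := hs.exists_sgn
  have hk2 := dep_of_eq_mul hk
  refine hs.multilinearExt_eq ?_ y
  rw [hk2, Finset.singleton_subset_singleton] at hsub
  rw [hk2, hsub, Finset.mem_singleton]

/-- The two block functions agree after substitution. -/
theorem realBlock_rowVals_eq {d : Params f g} (hd : d.IsBlockPartition)
    (hf : ∀ j ∈ cols d.Z₀, IsSignedInput (f j) ∨ 2 ≤ deg (f j))
    (hg : ∀ i ∈ rows d.Z₀, IsSignedInput (g i) ∨ 2 ≤ deg (g i))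
    (hfeq : ∀ j ∈ cols d.Z₀, ∀ x, f j x =
      (∏ i ∈ degTwo g (dep (f j)), (toReal (x i) + d.κ i j)) * d.φ j (fun i => x i) + d.B j)
    (hgeq : ∀ i ∈ rows d.Z₀, ∀ y, g i y =
      (∏ j ∈ degTwo f (dep (g i)), (toReal (y j) + d.κ i j)) * d.γ i (fun j => y j) + d.D i)
    (ℓ : Fin d.k) (Z : Fin n × Fin m → ℝ) :
    d.realBlock ℓ (rowVals g Z) = d.swap.realBlock ℓ (colVals f Z) := by
  have hcard : (d.swap.Z ℓ).card = (d.Z ℓ).card :=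
    Finset.card_image_of_injective _ Prod.swap_injective
  have hf' : ∀ j ∈ rows d.swap.Z₀, IsSignedInput (f j) ∨ 2 ≤ deg (f j) := by
    change ∀ j ∈ rows (d.Z₀.image Prod.swap), _
    rwa [rows_image_swap]
  by_cases hℓ : 1 < (d.Z ℓ).card
  · have hfeq' : ∀ j ∈ rows d.swap.Z₀, ∀ x, f j x =
        (∏ i ∈ degTwo g (dep (f j)), (toReal (x i) + d.swap.κ j i)) *
          d.swap.γ j (fun i => x i) + d.swap.D j := by
      change ∀ j ∈ rows (d.Z₀.image Prod.swap), _
      rwa [rows_image_swap]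
    rw [realBlock_rowVals_eq_prod hd hg hgeq hℓ, ← rowVals_swap,
      realBlock_rowVals_eq_prod hd.swap hf' hfeq' (hcard ▸ hℓ), rows_swap, cols_swap]
    -- Both double products run over the relevant entries in a heavy row and a heavy column of the
    -- block, grouped by rows on one side and by columns on the other.
    congr 1
    · refine Finset.prod_comm' fun i j => ?_
      simp only [mem_degTwo]
      constructor
      · rintro ⟨⟨hi, hi2⟩, hj, hj2⟩
        have hjc := hd.dep_row ℓ i hi hj
        exact ⟨⟨(hd.dep_iff ℓ i hi j hjc).1 hj, hi2⟩, hjc, hj2⟩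
      · rintro ⟨⟨hi, hi2⟩, hj, hj2⟩
        have hir := hd.dep_col ℓ j hj hi
        exact ⟨⟨hir, hi2⟩, (hd.dep_iff ℓ i hir j hj).2 hi, hj2⟩
    · exact mul_comm _ _
  · obtain ⟨⟨i, j⟩, hp⟩ := Finset.card_eq_one.1
      (le_antisymm (not_lt.1 hℓ) (Finset.card_pos.2 (hd.nonempty ℓ)))
    have hp' : d.swap.Z ℓ = {(j, i)} := by
      change (d.Z ℓ).image Prod.swap = _
      rw [hp]; simp
    rw [realBlock, realBlock, if_neg hℓ, if_neg (by rwa [hcard]), hp, hp', Finset.prod_singleton,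
      Finset.prod_singleton]
    simp only [rowVals, colVals]
    rw [hd.multilinearExt_of_singleton hg hp, hd.swap.multilinearExt_of_singleton hf' hp']
    ring

/-- The multilinear function `h` composed with the block functions is multiaffine. -/
theorem isMultiaffine_h_realBlock {d : Params f g} (hd : d.IsBlockPartition)
    (hg : ∀ i ∈ rows d.Z₀, IsSignedInput (g i) ∨ 2 ≤ deg (g i)) :
    IsMultiaffine fun x => multilinearExt d.h fun ℓ => d.realBlock ℓ x := by
  refine (isMultiaffine_multilinearExt d.h).comp (isMultiaffine_realBlock hd hg) _
    (dependsOn_realBlock hd) fun i a b ha hb => ?_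
  by_contra hab
  exact Finset.disjoint_left.1 (hd.rows_disjoint a b hab) ha hb

end Params

theorem rowComp_eq (f₀ : Cube (Fin n) → ℝ) (g : Fin n → Cube (Fin m) → ℝ)
    (Z : Cube (Fin n × Fin m)) :
    rowComp f₀ g Z = multilinearExt f₀ (rowVals g fun p => toReal (Z p)) := by
  rw [rowComp]
  congr 1
  funext i
  exact (multilinearExt_toReal (g i) fun j => Z (i, j)).symm

theorem colComp_eq (g₀ : Cube (Fin m) → ℝ) (f : Fin m → Cube (Fin n) → ℝ)
    (Z : Cube (Fin n × Fin m)) :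
    colComp g₀ f Z = multilinearExt g₀ (colVals f fun p => toReal (Z p)) := by
  rw [colComp]
  congr 1
  funext j
  exact (multilinearExt_toReal (f j) fun i => Z (i, j)).symm

/-- Both compositions are h evaluated at block values, and these agree block by block. Multiaffinity
ensures that the formulas for f₀ and g₀, given on the cube, persist at the real values of the inner
functions. -/
theorem Params.Represents.isGenPolymorphism {d : Params f g} {f₀ : Cube (Fin n) → ℝ}
    {g₀ : Cube (Fin m) → ℝ} (h : d.Represents f₀ g₀) (hd : d.IsBlockPartition)
    (hf : ∀ j ∈ cols d.Z₀, IsSignedInput (f j) ∨ 2 ≤ deg (f j))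
    (hg : ∀ i ∈ rows d.Z₀, IsSignedInput (g i) ∨ 2 ≤ deg (g i)) :
    IsGenPolymorphism f₀ f g₀ g := by
  intro Z
  have hf' : ∀ j ∈ rows d.swap.Z₀, IsSignedInput (f j) ∨ 2 ≤ deg (f j) := by
    change ∀ j ∈ rows (d.Z₀.image Prod.swap), _
    rwa [Params.rows_image_swap]
  rw [rowComp_eq, colComp_eq,
    (Params.isMultiaffine_h_realBlock hd hg).multilinearExt_eq fun x => by
      simp only [Params.realBlock_toReal]; exact h.f₀_eq x,
    (Params.isMultiaffine_h_realBlock hd.swap hf').multilinearExt_eq fun y => by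
      rw [h.g₀_eq]
      simp only [← Params.realBlock_swap_toReal]]
  simp only [Params.realBlock_rowVals_eq hd hf hg h.f_eq h.g_eq]

end Blocks

end GenPoly

namespace GenPoly

/-! ### Divisibility, the functional equation, blockwise affine functions and components -/

section General

variable {ι κ : Type*}

/-- If a multiaffine function vanishes on the hyperplanes `y_j = -c_j` for `j ∈ s`, then it is
divisible by `∏ j ∈ s, (y_j + c_j)`. -/
theorem IsMultiaffine.eq_prod_mul [DecidableEq ι] {P : (ι → ℝ) → ℝ} (hP : IsMultiaffine P) (c : ι → ℝ)
    (s : Finset ι) (h : ∀ j ∈ s, ∀ y : ι → ℝ, y j = -c j → P y = 0) (y : ι → ℝ) :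
    P y = (∏ j ∈ s, (y j + c j)) * P fun k => if k ∈ s then 1 - c k else y k := by
  induction s using Finset.induction_on generalizing y with
  | empty => simp
  | insert j s hj ih =>
    -- An affine function of z_j vanishing at -c_j is z_j + c_j times its value at 1 - c_j, where
    -- the linear factor equals 1.
    have h1 : ∀ z : ι → ℝ, P z = (z j + c j) * P (Function.update z j (1 - c j)) := by
      intro z
      have h0 := h j (Finset.mem_insert_self j s) (Function.update z j (-c j)) (by simp)
      rw [hP.eq_update z j (-c j), hP.update_eq z j (-c j) (1 - c j), h0]
      ring
    rw [ih (fun k hk => h k (Finset.mem_insert_of_mem hk)) y, Finset.prod_insert hj, h1]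
    simp only [if_neg hj]
    have : Function.update (fun k => if k ∈ s then 1 - c k else y k) j (1 - c j) =
        fun k => if k ∈ insert j s then 1 - c k else y k := by
      funext k
      by_cases hk : k = j
      · subst hk; simp
      · simp [hk]
    rw [this]
    ring

/-- If a function is divisible by nonzero functions `a_s` of disjoint sets `V_s` of variables, with
quotients not depending on the respective set, then it is divisible by their product. -/
theorem exists_eq_prod_mul {σ : Type*} (I : Finset σ) (V : σ → Set ι)
    (hV : ∀ s ∈ I, ∀ t ∈ I, s ≠ t → Disjoint (V s) (V t)) (a : σ → (ι → ℝ) → ℝ)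
    (ha : ∀ s ∈ I, DependsOn (a s) (V s)) (ha0 : ∀ s ∈ I, ∃ x, a s x ≠ 0) (G : (ι → ℝ) → ℝ)
    (hG : ∀ s ∈ I, ∃ A : (ι → ℝ) → ℝ, DependsOn A (V s)ᶜ ∧ ∀ x, G x = a s x * A x) :
    ∃ T : (ι → ℝ) → ℝ, DependsOn T (⋃ s ∈ I, V s)ᶜ ∧ ∀ x, G x = (∏ s ∈ I, a s x) * T x := by
  classical
  induction I using Finset.induction_on with
  | empty => exact ⟨G, by simpa using dependsOn_univ G, by simp⟩
  | insert s I hs ih =>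
    obtain ⟨T, hT, hGT⟩ := ih
      (fun s hs t ht => hV s (Finset.mem_insert_of_mem hs) t (Finset.mem_insert_of_mem ht))
      (fun s hs => ha s (Finset.mem_insert_of_mem hs))
      (fun s hs => ha0 s (Finset.mem_insert_of_mem hs))
      (fun s hs => hG s (Finset.mem_insert_of_mem hs))
    obtain ⟨A, hA, hGA⟩ := hG s (Finset.mem_insert_self s I)
    choose! p hp using ha0
    have hex : ∃ q : ι → ℝ, ∀ t ∈ I, ∀ i ∈ V t, q i = p t i := by
      refine ⟨fun i => if h : ∃ t ∈ I, i ∈ V t then p h.choose i else 0, fun t ht i hi => ?_⟩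
      have h : ∃ t ∈ I, i ∈ V t := ⟨t, ht, hi⟩
      dsimp only
      rw [dif_pos h]
      have : h.choose = t := by
        by_contra hne
        exact Set.disjoint_left.1 (hV _ (Finset.mem_insert_of_mem h.choose_spec.1) t
          (Finset.mem_insert_of_mem ht) hne) h.choose_spec.2 hi
      rw [this]
    obtain ⟨q, hq⟩ := hex
    -- `r` overwrites the variables of the sets already treated by a point where their factors do
    -- not vanish. Comparing the two factorizations of G at `r x` shows that T is `a s` times a
    -- quotient free of all the sets.
    set r : (ι → ℝ) → ι → ℝ := fun x i => if i ∈ ⋃ t ∈ I, V t then q i else x i with hr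
    have hr1 : ∀ x, ∀ t ∈ I, a t (r x) = a t (p t) := by
      intro x t ht
      refine ha t (Finset.mem_insert_of_mem ht) fun i hi => ?_
      have : i ∈ ⋃ t ∈ I, V t := Set.mem_biUnion ht hi
      simp only [hr, if_pos this, hq t ht i hi]
    have hr2 : ∀ x, T (r x) = T x := by
      intro x
      refine hT fun i hi => ?_
      simp only [hr]
      rw [if_neg hi]
    have hr3 : ∀ x, a s (r x) = a s x := by
      intro x
      refine ha s (Finset.mem_insert_self s I) fun i hi => ?_
      simp only [hr]
      rw [if_neg]
      intro h
      obtain ⟨t, ht, hit⟩ := Set.mem_iUnion₂.1 h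
      exact Set.disjoint_left.1 (hV s (Finset.mem_insert_self s I) t (Finset.mem_insert_of_mem ht)
        (by rintro rfl; exact hs ht)) hi hit
    have hprod : ∏ t ∈ I, a t (p t) ≠ 0 :=
      Finset.prod_ne_zero_iff.2 fun t ht => hp t (Finset.mem_insert_of_mem ht)
    refine ⟨fun x => A (r x) / ∏ t ∈ I, a t (p t), ?_, ?_⟩
    · intro x y hxy
      dsimp only
      congr 1
      refine hA fun i hi => ?_
      simp only [hr]
      split_ifs with h
      · rfl
      · refine hxy i ?_
        rw [Finset.set_biUnion_insert]
        simp only [Set.mem_compl_iff, Set.mem_union, not_or]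
        exact ⟨hi, h⟩
    · intro x
      have h1 := hGT (r x)
      rw [hGA, hr2, hr3, Finset.prod_congr rfl (hr1 x)] at h1
      rw [hGT, Finset.prod_insert hs]
      have h2 : T x = a s x * (A (r x) / ∏ t ∈ I, a t (p t)) := by
        rw [mul_div_assoc', eq_div_iff hprod, h1, mul_comm]
      rw [h2]; ring

/-- The functional equation behind the factorizations of `f_j` and `g_i`. -/
theorem exists_affine_of_separated {R C : Type*} {u s b q : R → ℝ} {v t a p : C → ℝ}
    (h1 : ∀ r c, a c * u r = b r * v c) (h2 : ∀ r c, p c + a c * s r = q r + b r * t c)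
    (hu : ∃ r r', u r ≠ u r') (hv : ∃ c c', v c ≠ v c') (ha : ∃ c, a c ≠ 0) :
    ∃ K D E : ℝ, (∀ r, s r = K * u r + D) ∧ ∀ c, t c = K * v c + E := by
  have hu0 : ∃ r, u r ≠ 0 := by
    obtain ⟨r, r', h⟩ := hu
    by_contra! h0
    exact h (by rw [h0, h0])
  have hv0 : ∃ c, v c ≠ 0 := by
    obtain ⟨r, r', h⟩ := hv
    by_contra! h0
    exact h (by rw [h0, h0])
  obtain ⟨r₀, hr₀⟩ := hu0
  obtain ⟨c₀, hc₀⟩ := hv0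
  -- The constant ratio: `h1` gives a = w v and b = w u, and w ≠ 0 since a is not identically zero.
  set w := b r₀ / u r₀
  have hA : ∀ c, a c = w * v c := fun c => by
    rw [div_mul_eq_mul_div, eq_div_iff hr₀, h1]
  have hw : w ≠ 0 := by
    rintro h
    obtain ⟨c, hc⟩ := ha
    exact hc (by rw [hA, h, zero_mul])
  have hB : ∀ r, b r = w * u r := fun r => by
    apply mul_right_cancel₀ hc₀
    rw [← h1, hA]; ring
  obtain ⟨c₁, c₂, hc⟩ := hv
  obtain ⟨r₁, r₂, hr⟩ := hu
  have hc' : w * (v c₁ - v c₂) ≠ 0 := mul_ne_zero hw (sub_ne_zero.2 hc)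
  have hr' : w * (u r₁ - u r₂) ≠ 0 := mul_ne_zero hw (sub_ne_zero.2 hr)
  -- Subtracting `h2` at two values of c eliminates q and shows that s is affine in u; `ht` is the
  -- same with r and c exchanged.
  have hs : ∀ r, s r = (w * (t c₁ - t c₂)) / (w * (v c₁ - v c₂)) * u r +
      (p c₂ - p c₁) / (w * (v c₁ - v c₂)) := by
    intro r
    have e1 := h2 r c₁
    have e2 := h2 r c₂
    rw [hA, hB] at e1 e2
    rw [div_mul_eq_mul_div, ← add_div, eq_div_iff hc']
    linear_combination e1 - e2
  have ht : ∀ c, t c = (w * (s r₁ - s r₂)) / (w * (u r₁ - u r₂)) * v c +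
      (q r₂ - q r₁) / (w * (u r₁ - u r₂)) := by
    intro c
    have e1 := h2 r₁ c
    have e2 := h2 r₂ c
    rw [hA, hB] at e1 e2
    rw [div_mul_eq_mul_div, ← add_div, eq_div_iff hr']
    linear_combination e2 - e1
  refine ⟨_, _, (q r₂ - q r₁) / (w * (u r₁ - u r₂)), hs, fun c => ?_⟩
  rw [ht c]
  -- The two slopes agree: the difference quotient of s with respect to u that occurs in `ht` is the
  -- slope found in `hs`.
  congr 2
  rw [hs r₁, hs r₂, div_eq_iff hr']
  ring

/-- A function which is affine in each of the functions `M_ℓ` of disjoint sets of variables depends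
only on their values. -/
theorem eq_of_blocks_eq [Fintype κ] {F : (ι → ℝ) → ℝ} {V : κ → Set ι}
    (hV : ∀ a b, a ≠ b → Disjoint (V a) (V b)) (hF : DependsOn F (⋃ a, V a))
    {M : κ → (ι → ℝ) → ℝ} (hM : ∀ a, DependsOn (M a) (V a))
    (hFM : ∀ a, ∃ c Q : (ι → ℝ) → ℝ, DependsOn c (V a)ᶜ ∧ DependsOn Q (V a)ᶜ ∧
      ∀ x, F x = c x * M a x + Q x)
    {x y : ι → ℝ} (hxy : ∀ a, M a x = M a y) : F x = F y := by
  classical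
  -- The blocks of x are replaced by those of y one at a time; each replacement enters F only
  -- through the value of M_a, which is unchanged.
  have key : ∀ s : Finset κ, F x = F fun i => if ∃ a ∈ s, i ∈ V a then y i else x i := by
    intro s
    induction s using Finset.induction_on with
    | empty => simp
    | insert a s ha ih =>
      rw [ih]
      obtain ⟨c, Q, hc, hQ, hFa⟩ := hFM a
      have hoff : ∀ i ∈ (V a)ᶜ, (if ∃ b ∈ s, i ∈ V b then y i else x i) =
          if ∃ b ∈ insert a s, i ∈ V b then y i else x i := by
        intro i hi
        congr 1
        simp only [Finset.exists_mem_insert, eq_iff_iff]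
        exact ⟨Or.inr, fun h => h.resolve_left hi⟩
      rw [hFa, hFa fun i => if ∃ b ∈ insert a s, i ∈ V b then y i else x i, hc hoff, hQ hoff]
      congr 2
      calc M a _ = M a x := hM a fun i hi => by
            rw [if_neg]
            rintro ⟨b, hb, hib⟩
            exact Set.disjoint_left.1 (hV a b (by rintro rfl; exact ha hb)) hi hib
        _ = M a y := hxy a
        _ = _ := hM a fun i hi => by
            rw [if_pos ⟨a, Finset.mem_insert_self a s, hi⟩]
  rw [key Finset.univ]
  refine hF fun i hi => ?_
  obtain ⟨a, ha⟩ := Set.mem_iUnion.1 hi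
  rw [if_pos ⟨a, Finset.mem_univ a, ha⟩]

/-- A multiaffine function which is affine in each of the multiaffine functions `M_ℓ` of disjoint
sets of variables is a multiaffine function of the `M_ℓ`. -/
theorem exists_multilinearExt_comp_eq [Fintype κ] [DecidableEq κ] [Fintype ι] [DecidableEq ι]
    {F : (ι → ℝ) → ℝ}
    (hFm : IsMultiaffine F) {V : κ → Set ι} (hV : ∀ a b, a ≠ b → Disjoint (V a) (V b))
    (hF : DependsOn F (⋃ a, V a)) {M : κ → (ι → ℝ) → ℝ} (hMm : ∀ a, IsMultiaffine (M a))
    (hM : ∀ a, DependsOn (M a) (V a))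
    (hFM : ∀ a, ∃ c Q : (ι → ℝ) → ℝ, DependsOn c (V a)ᶜ ∧ DependsOn Q (V a)ᶜ ∧
      ∀ x, F x = c x * M a x + Q x)
    (hne : ∀ a, ∃ i ∈ V a, ∃ x, slopeAt F i x ≠ 0) :
    ∃ h : Cube κ → ℝ, dep h = Finset.univ ∧ ∀ x, F x = multilinearExt h fun a => M a x := by
  classical
  choose e he p hp using hne
  have hinj : ∀ a b, e a = e b → a = b := by
    intro a b hab
    by_contra hne
    exact Set.disjoint_left.1 (hV a b hne) (he a) (hab ▸ he b)
  -- The slope of F along `e a` is c times that of M_a, so the latter is nonzero as well.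
  have hd : ∀ a, slopeAt (M a) (e a) (p a) ≠ 0 := by
    intro a h0
    obtain ⟨c, Q, hc, hQ, hFa⟩ := hFM a
    apply hp a
    have hi : e a ∉ (V a)ᶜ := fun h => h (he a)
    have : slopeAt F (e a) (p a) = c (p a) * slopeAt (M a) (e a) (p a) := by
      simp only [slopeAt, hFa, update_eq_of_dependsOn hc hi, update_eq_of_dependsOn hQ hi]
      ring
    rw [this, h0, mul_zero]
  set m : κ → ℝ := fun a => M a (Function.update (p a) (e a) 0)
  set d : κ → ℝ := fun a => slopeAt (M a) (e a) (p a)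
  -- A section of the M_a: in each block all variables but `e a` are frozen at `p a`, and `e a` is
  -- solved from M_a = t_a, which is affine in it. The value 0 outside the blocks is immaterial.
  -- Then h(t) = F(σ(t)).
  set σ : ι → (κ → ℝ) → ℝ := fun i t => if h : ∃ a, e a = i then
    1 / d h.choose * t h.choose + -(m h.choose / d h.choose)
    else if h : ∃ a, i ∈ V a then p h.choose i else 0 with hσ
  have hσe : ∀ a t, σ (e a) t = (t a - m a) / d a := by
    intro a t
    have h : ∃ b, e b = e a := ⟨a, rfl⟩
    have hc : h.choose = a := hinj _ _ h.choose_spec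
    simp only [hσ, dif_pos h, hc]
    ring
  have hσV : ∀ a t, ∀ i ∈ V a, i ≠ e a → σ i t = p a i := by
    intro a t i hi hie
    have h1 : ¬ ∃ b, e b = i := by
      rintro ⟨b, rfl⟩
      apply hie
      by_cases hab : b = a
      · rw [hab]
      · exact (Set.disjoint_left.1 (hV b a hab) (he b) hi).elim
    have h2 : ∃ b, i ∈ V b := ⟨a, hi⟩
    have hc : h2.choose = a := by
      by_contra hne
      exact Set.disjoint_left.1 (hV _ a hne) h2.choose_spec hi
    simp only [hσ, dif_neg h1, dif_pos h2, hc]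
  have hMσ : ∀ a t, M a (fun i => σ i t) = t a := by
    intro a t
    have h1 : M a (fun i => σ i t) = M a (Function.update (p a) (e a) ((t a - m a) / d a)) := by
      refine hM a fun i hi => ?_
      by_cases hie : i = e a
      · subst hie; simp [hσe]
      · rw [Function.update_of_ne hie, hσV a t i hi hie]
    rw [h1, (hMm a).update_eq _ _ 0]
    have : d a ≠ 0 := hd a
    change m a + _ * d a = _
    field_simp
    ring
  have hFσ : IsMultiaffine fun t => F fun i => σ i t := by
    refine hFm.comp (P := σ) (fun i => ?_) (fun i => {a | e a = i}) (fun i => ?_) ?_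
    · simp only [hσ]
      split_ifs with h h'
      · exact (isMultiaffine_coord _ _).add (isMultiaffine_const _)
      · exact isMultiaffine_const _
      · exact isMultiaffine_const _
    · intro t t' htt
      simp only [hσ]
      split_ifs with h h'
      · rw [htt _ h.choose_spec]
      · rfl
      · rfl
    · intro a i i' h1 h2
      exact h1.symm.trans h2
  have hext : multilinearExt (fun t : Cube κ => F fun i => σ i fun a => toReal (t a)) =
      fun t => F fun i => σ i t := hFσ.multilinearExt_eq fun _ => rfl
  have hmain : ∀ x, F x =
      multilinearExt (fun t : Cube κ => F fun i => σ i fun a => toReal (t a)) fun a => M a x := by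
    intro x
    rw [hext]
    exact eq_of_blocks_eq hV hF hM hFM fun a =>
      (hMσ a fun a => M a x).symm
  refine ⟨_, ?_, hmain⟩
  rw [Finset.eq_univ_iff_forall]
  intro a
  -- If h ignored its a-th input, F would ignore the variable `e a`, which occurs in no other block.
  by_contra hna
  apply hp a
  rw [slopeAt, hmain, hmain, sub_eq_zero]
  refine dependsOn_multilinearExt _ fun b hb => ?_
  have hba : b ≠ a := by
    rintro rfl
    exact hna (by simpa using hb)
  have hi : e a ∉ V b := fun h => Set.disjoint_left.1 (hV b a hba) h (he a)
  rw [update_eq_of_dependsOn (hM b) hi, update_eq_of_dependsOn (hM b) hi]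

/-- The connected components of a set of entries. -/
theorem exists_components {n m : ℕ} (Z₀ : Finset (Fin n × Fin m)) :
    ∃ (k : ℕ) (Z : Fin k → Finset (Fin n × Fin m)), (∀ ℓ, (Z ℓ).Nonempty) ∧
      Z₀ = Finset.univ.biUnion Z ∧
      (∀ ℓ ℓ', ∀ p ∈ Z ℓ, ∀ q ∈ Z ℓ', (p.1 = q.1 ∨ p.2 = q.2) → ℓ = ℓ') ∧
      ∀ ℓ, ∀ p ∈ Z ℓ, ∀ q ∈ Z ℓ,
        Relation.ReflTransGen (fun a b => b ∈ Z ℓ ∧ (a.1 = b.1 ∨ a.2 = b.2)) p q := by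
  classical
  let adj : Z₀ → Z₀ → Prop := fun a b => a.1.1 = b.1.1 ∨ a.1.2 = b.1.2
  have hsymm : ∀ a b, adj a b → adj b a := fun a b h => h.imp Eq.symm Eq.symm
  let S : Setoid Z₀ :=
    { r := Relation.ReflTransGen adj
      iseqv := ⟨fun _ => Relation.ReflTransGen.refl,
        fun h => by
          induction h with
          | refl => exact Relation.ReflTransGen.refl
          | tail _ h ih => exact Relation.ReflTransGen.head (hsymm _ _ h) ih,
        fun h h' => h.trans h'⟩ }
  let e := Fintype.equivFin (Quotient S)
  let col : Z₀ → Fin (Fintype.card (Quotient S)) := fun p => e (Quotient.mk S p)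
  have hcol : ∀ p q, col p = col q ↔ Relation.ReflTransGen adj p q := fun p q =>
    e.injective.eq_iff.trans Quotient.eq
  let Z : Fin (Fintype.card (Quotient S)) → Finset (Fin n × Fin m) := fun ℓ =>
    (Finset.univ.filter fun p => col p = ℓ).image Subtype.val
  have hZ : ∀ ℓ p, p ∈ Z ℓ ↔ ∃ h : p ∈ Z₀, col ⟨p, h⟩ = ℓ := by
    intro ℓ p
    simp [Z]
  refine ⟨_, Z, fun ℓ => ?_, ?_, ?_, ?_⟩
  · obtain ⟨q, hq⟩ := Quotient.exists_rep (e.symm ℓ)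
    exact ⟨q.1, (hZ ℓ q.1).2 ⟨q.2, by simp [col, hq]⟩⟩
  · ext p
    simp only [Finset.mem_biUnion, Finset.mem_univ, true_and, hZ]
    exact ⟨fun h => ⟨_, h, rfl⟩, fun ⟨_, h, _⟩ => h⟩
  · intro ℓ ℓ' p hp q hq hpq
    obtain ⟨h, rfl⟩ := (hZ _ _).1 hp
    obtain ⟨h', rfl⟩ := (hZ _ _).1 hq
    exact (hcol _ _).2 (Relation.ReflTransGen.single hpq)
  · intro ℓ p hp q hq
    obtain ⟨h, rfl⟩ := (hZ _ _).1 hp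
    obtain ⟨h', hq'⟩ := (hZ _ _).1 hq
    have key : ∀ q', Relation.ReflTransGen adj ⟨p, h⟩ q' → Relation.ReflTransGen
        (fun a b => b ∈ Z (col ⟨p, h⟩) ∧ (a.1 = b.1 ∨ a.2 = b.2)) p q'.1 := by
      intro q' hr
      induction hr with
      | refl => exact Relation.ReflTransGen.refl
      | @tail b c hb hbc ih =>
        exact ih.tail ⟨(hZ _ _).2 ⟨c.2, ((hcol _ _).2 (hb.tail hbc)).symm⟩, hbc⟩
    exact key ⟨q, h'⟩ ((hcol _ _).1 hq'.symm)

end General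

end GenPoly

namespace GenPoly

/-! ### Compositions over a matrix, relevant entries, and the constants κ, D and B -/

section Composition

variable {n m : ℕ} {f₀ : Cube (Fin n) → ℝ} {f : Fin m → Cube (Fin n) → ℝ}
  {g₀ : Cube (Fin m) → ℝ} {g : Fin n → Cube (Fin m) → ℝ}

theorem IsMultiaffine.comp_rowVals {P : (Fin n → ℝ) → ℝ} (hP : IsMultiaffine P)
    (g : Fin n → Cube (Fin m) → ℝ) : IsMultiaffine fun Z => P (rowVals g Z) := by
  refine hP.comp (P := fun i Z => rowVals g Z i) (fun i => ?_) (fun i => {p | p.1 = i})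
    (fun i Z Z' hZ => ?_) ?_
  · refine (isMultiaffine_multilinearExt (g i)).comp (P := fun j Z => Z (i, j)) (fun j => ?_)
      (fun j => {(i, j)}) (fun j Z Z' hZ => hZ _ rfl) ?_
    · simpa using isMultiaffine_coord (i, j) 1
    · rintro p j j' rfl h
      exact (Prod.ext_iff.1 h).2
  · exact congrArg (multilinearExt (g i)) (funext fun j => hZ (i, j) rfl)
  · intro p i i' h h'
    exact h.symm.trans h'

theorem IsMultiaffine.comp_colVals {P : (Fin m → ℝ) → ℝ} (hP : IsMultiaffine P)
    (f : Fin m → Cube (Fin n) → ℝ) : IsMultiaffine fun Z => P (colVals f Z) := by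
  intro Z p t
  have := hP.comp_rowVals f (fun q => Z q.swap) p.swap t
  have key : ∀ s, (fun q : Fin m × Fin n => Function.update Z p s q.swap) =
      Function.update (fun q => Z q.swap) p.swap s := by
    intro s
    funext q
    by_cases h : q = p.swap
    · subst h; simp
    · have : q.swap ≠ p := fun e => h (by rw [← e, Prod.swap_swap])
      simp [h, this]
  simpa only [← rowVals_swap, key] using this

theorem multilinearExt_rowComp (f₀ : Cube (Fin n) → ℝ) (g : Fin n → Cube (Fin m) → ℝ) :
    multilinearExt (rowComp f₀ g) = fun Z => multilinearExt f₀ (rowVals g Z) :=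
  ((isMultiaffine_multilinearExt f₀).comp_rowVals g).multilinearExt_eq (rowComp_eq f₀ g)

/-- Both sides are multiaffine in the entries and agree on the cube. Real entries matter because the
hyperplanes z_ij = -κ_ij need not meet the cube. -/
theorem IsGenPolymorphism.real_eq (h : IsGenPolymorphism f₀ f g₀ g) (Z : Fin n × Fin m → ℝ) :
    multilinearExt f₀ (rowVals g Z) = multilinearExt g₀ (colVals f Z) := by
  refine congrFun (((isMultiaffine_multilinearExt f₀).comp_rowVals g).eq_of_cube
    ((isMultiaffine_multilinearExt g₀).comp_colVals f) fun Z => ?_) Z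
  rw [← rowComp_eq, ← colComp_eq, h Z]

/-- Composition with non-constant functions of disjoint sets of variables is injective. -/
theorem IsMultiaffine.eq_of_rowVals {P Q : (Fin n → ℝ) → ℝ} (hP : IsMultiaffine P)
    (hQ : IsMultiaffine Q) (hg : ∀ i, NonConstant (g i))
    (h : ∀ Z, P (rowVals g Z) = Q (rowVals g Z)) : P = Q := by
  classical
  choose x y hxy using hg
  refine hP.eq_of_grid hQ hxy fun v hv => ?_
  -- Each g_i takes two distinct values and the rows are independent, so every point of the
  -- resulting grid is a vector of row values.
  have : v = rowVals g fun p => toReal ((if v p.1 = g p.1 (x p.1) then x p.1 else y p.1) p.2) := by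
    funext i
    rw [rowVals]
    dsimp only
    rw [multilinearExt_toReal]
    split_ifs with h1
    · exact h1
    · exact (hv i).resolve_left h1
  rw [this]
  exact h _

theorem IsMultiaffine.eq_of_colVals {P Q : (Fin m → ℝ) → ℝ} (hP : IsMultiaffine P)
    (hQ : IsMultiaffine Q) (hf : ∀ j, NonConstant (f j))
    (h : ∀ Z, P (colVals f Z) = Q (colVals f Z)) : P = Q :=
  hP.eq_of_rowVals hQ hf fun Z => h fun p => Z p.swap

theorem exists_slopeAt_rowVals_ne_zero (hg : ∀ i, NonConstant (g i)) {i : Fin n}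
    (hi : i ∈ dep f₀) : ∃ Z, slopeAt (multilinearExt f₀) i (rowVals g Z) ≠ 0 := by
  by_contra! h
  obtain ⟨x, hx⟩ := exists_slopeAt_ne_zero hi
  exact hx (congrFun (((isMultiaffine_multilinearExt f₀).slope i).eq_of_rowVals
    (isMultiaffine_const 0) hg h) x)

theorem rowVals_update (g : Fin n → Cube (Fin m) → ℝ) (Z : Fin n × Fin m → ℝ) (i : Fin n)
    (j : Fin m) (t : ℝ) : rowVals g (Function.update Z (i, j) t) =
      Function.update (rowVals g Z) i
        (multilinearExt (g i) (Function.update (fun j => Z (i, j)) j t)) := by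
  funext k
  by_cases h : k = i
  · subst h
    rw [Function.update_self, rowVals]
    congr 1
    funext l
    by_cases hl : l = j
    · subst hl; simp
    · simp [hl]
  · rw [Function.update_of_ne h, rowVals, rowVals]
    congr 1
    funext l
    simp [h]

theorem colVals_update (f : Fin m → Cube (Fin n) → ℝ) (Z : Fin n × Fin m → ℝ) (i : Fin n)
    (j : Fin m) (t : ℝ) : colVals f (Function.update Z (i, j) t) =
      Function.update (colVals f Z) j
        (multilinearExt (f j) (Function.update (fun i => Z (i, j)) i t)) := by
  funext k
  by_cases h : k = j
  · subst h
    rw [Function.update_self, colVals]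
    congr 1
    funext l
    by_cases hl : l = i
    · subst hl; simp
    · simp [hl]
  · rw [Function.update_of_ne h, colVals, colVals]
    congr 1
    funext l
    simp [h]

/-- The chain rule, exact for finite differences because the outer function is affine in its i-th
variable. -/
theorem slopeAt_rowVals (f₀ : Cube (Fin n) → ℝ) (g : Fin n → Cube (Fin m) → ℝ) (i : Fin n)
    (j : Fin m) (Z : Fin n × Fin m → ℝ) :
    slopeAt (fun Z => multilinearExt f₀ (rowVals g Z)) (i, j) Z =
      slopeAt (multilinearExt f₀) i (rowVals g Z) *
        slopeAt (multilinearExt (g i)) j fun j => Z (i, j) := by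
  have := (isMultiaffine_multilinearExt f₀).update_eq (rowVals g Z) i
    (multilinearExt (g i) (Function.update (fun j => Z (i, j)) j 0))
    (multilinearExt (g i) (Function.update (fun j => Z (i, j)) j 1))
  simp only [slopeAt, rowVals_update] at this ⊢
  linear_combination this

/-- Both factors of the chain rule can be made nonzero at once: the slope of f₀ in direction i does
not involve row i, which may therefore be chosen freely. -/
theorem mem_dep_rowComp (hf₀ : dep f₀ = Finset.univ) (hg : ∀ i, NonConstant (g i)) (i : Fin n)
    (j : Fin m) : (i, j) ∈ dep (rowComp f₀ g) ↔ j ∈ dep (g i) := by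
  rw [mem_dep_iff_slopeAt, mem_dep_iff_slopeAt, multilinearExt_rowComp]
  simp only [slopeAt_rowVals]
  constructor
  · rintro ⟨Z, hZ⟩
    exact ⟨_, right_ne_zero_of_mul hZ⟩
  · rintro ⟨y, hy⟩
    obtain ⟨Z, hZ⟩ := exists_slopeAt_rowVals_ne_zero hg (show i ∈ dep f₀ by simp [hf₀])
    refine ⟨fun p => if p.1 = i then y p.2 else Z p, mul_ne_zero ?_ (by simpa using hy)⟩
    have : rowVals g (fun p => if p.1 = i then y p.2 else Z p) =
        Function.update (rowVals g Z) i (multilinearExt (g i) y) := by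
      funext k
      by_cases h : k = i
      · subst h; simp [rowVals]
      · simp [rowVals, h]
    rwa [this, slopeAt_update]

/-- The same composition, read by rows and by columns, has the same relevant entries. -/
theorem IsGenPolymorphism.mem_dep_iff (h : IsGenPolymorphism f₀ f g₀ g)
    (hf₀ : dep f₀ = Finset.univ) (hg₀ : dep g₀ = Finset.univ) (hf : ∀ j, NonConstant (f j))
    (hg : ∀ i, NonConstant (g i)) (i : Fin n) (j : Fin m) : j ∈ dep (g i) ↔ i ∈ dep (f j) := by
  rw [← mem_dep_rowComp hf₀ hg, ← mem_dep_rowComp hg₀ hf, mem_dep_iff_slopeAt, mem_dep_iff_slopeAt,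
    multilinearExt_rowComp, multilinearExt_rowComp]
  have key : ∀ Z : Fin n × Fin m → ℝ,
      slopeAt (fun Z => multilinearExt f₀ (rowVals g Z)) (i, j) Z =
        slopeAt (fun Z => multilinearExt g₀ (rowVals f Z)) (j, i) fun p => Z p.swap := by
    intro Z
    have e : ∀ t, (fun p : Fin m × Fin n => Function.update Z (i, j) t p.swap) =
        Function.update (fun p => Z p.swap) (j, i) t := by
      intro t
      funext ⟨a, b⟩
      by_cases hb : b = i <;> by_cases ha : a = j <;> simp [ha, hb]
    simp only [slopeAt, h.real_eq, ← rowVals_swap, e]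
  exact ⟨fun ⟨Z, hZ⟩ => ⟨_, key Z ▸ hZ⟩, fun ⟨Z, hZ⟩ => ⟨fun p => Z p.swap, by rw [key]; exact hZ⟩⟩

/-- If `g_i` and `f_j` are not affine in a common variable `z_ij`, then both are constant on the same
hyperplane `z_ij = -κ`. -/
theorem IsGenPolymorphism.exists_hyperplane (h : IsGenPolymorphism f₀ f g₀ g)
    (hg : ∀ i, NonConstant (g i)) {i : Fin n} {j : Fin m} (hi : i ∈ dep f₀)
    (hu : ∃ x y, slopeAt (multilinearExt (g i)) j x ≠ slopeAt (multilinearExt (g i)) j y)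
    (hv : ∃ x y, slopeAt (multilinearExt (f j)) i x ≠ slopeAt (multilinearExt (f j)) i y) :
    ∃ K D E : ℝ, (∀ y : Fin m → ℝ, y j = -K → multilinearExt (g i) y = D) ∧
      ∀ x : Fin n → ℝ, x i = -K → multilinearExt (f j) x = E := by
  obtain ⟨R, hR⟩ := exists_slopeAt_rowVals_ne_zero hg hi
  set X : (Fin n → ℝ) → Fin n → ℝ := fun c a =>
    multilinearExt (g a) fun b => if b = j then c a else R (a, b) with hX
  set Y : (Fin m → ℝ) → Fin m → ℝ := fun r b =>
    multilinearExt (f b) fun a => if a = i then r b else R (a, b) with hY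
  have hP := isMultiaffine_multilinearExt f₀
  have hQ := isMultiaffine_multilinearExt g₀
  -- Here `z` is the entry (i, j), `r` the rest of row i and `c` the rest of column j; all other
  -- entries are frozen at `R`.
  have key : ∀ z r c, multilinearExt f₀
      (Function.update (X c) i (multilinearExt (g i) (Function.update r j z))) =
      multilinearExt g₀
        (Function.update (Y r) j (multilinearExt (f j) (Function.update c i z))) := by
    intro z r c
    have := h.real_eq fun p => if p.1 = i then (if p.2 = j then z else r p.2) else
      if p.2 = j then c p.1 else R p
    convert this using 2
    · funext a
      by_cases ha : a = i
      · subst ha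
        rw [Function.update_self, rowVals]
        congr 1
        funext b
        by_cases hb : b = j <;> simp [hb]
      · rw [Function.update_of_ne ha, rowVals]
        simp [hX, ha]
    · funext b
      by_cases hb : b = j
      · subst hb
        rw [Function.update_self, colVals]
        congr 1
        funext a
        by_cases ha : a = i <;> simp [ha]
      · rw [Function.update_of_ne hb, colVals]
        simp [hY, hb]
  have key0 : ∀ z r c, multilinearExt f₀ (Function.update (X c) i 0) +
      slopeAt (multilinearExt f₀) i (X c) * (multilinearExt (g i) (Function.update r j 0) +
        z * slopeAt (multilinearExt (g i)) j r) =
      multilinearExt g₀ (Function.update (Y r) j 0) +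
      slopeAt (multilinearExt g₀) j (Y r) * (multilinearExt (f j) (Function.update c i 0) +
        z * slopeAt (multilinearExt (f j)) i c) := by
    intro z r c
    have := key z r c
    rw [hP.update_eq _ i 0, hQ.update_eq _ j 0,
      (isMultiaffine_multilinearExt (g i)).update_eq r j 0 z,
      (isMultiaffine_multilinearExt (f j)).update_eq c i 0 z] at this
    linear_combination this
  obtain ⟨K, D, E, hs, ht⟩ := exists_affine_of_separated
    (u := slopeAt (multilinearExt (g i)) j) (v := slopeAt (multilinearExt (f j)) i)
    (a := fun c => slopeAt (multilinearExt f₀) i (X c))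
    (b := fun r => slopeAt (multilinearExt g₀) j (Y r))
    (s := fun r => multilinearExt (g i) (Function.update r j 0))
    (t := fun c => multilinearExt (f j) (Function.update c i 0))
    (p := fun c => multilinearExt f₀ (Function.update (X c) i 0))
    (q := fun r => multilinearExt g₀ (Function.update (Y r) j 0))
    (fun r c => by linear_combination key0 1 r c - key0 0 r c)
    (fun r c => by linear_combination key0 0 r c) hu hv
    -- With column j also taken from `R`, the vector `X c` is that of the row values of `R`, where
    -- the slope of f₀ is nonzero.
    ⟨fun a => R (a, j), by
      convert hR using 3
      funext a
      rw [rowVals, hX]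
      dsimp only
      congr 1
      funext b
      by_cases hb : b = j <;> simp [hb]⟩
  refine ⟨K, D, E, fun y hy => ?_, fun x hx => ?_⟩
  · rw [(isMultiaffine_multilinearExt (g i)).eq_update y j 0, hs, hy]; ring
  · rw [(isMultiaffine_multilinearExt (f j)).eq_update x i 0, ht, hx]; ring

/-- The constants `κ_ij`, `D_i` and `B_j`. -/
theorem IsGenPolymorphism.exists_constants (h : IsGenPolymorphism f₀ f g₀ g)
    (hf₀ : dep f₀ = Finset.univ) (hg₀ : dep g₀ = Finset.univ)
    (hf : ∀ j, IsBooleanLike (f j) ∧ NonConstant (f j))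
    (hg : ∀ i, IsBooleanLike (g i) ∧ NonConstant (g i)) :
    ∃ (κ : Fin n → Fin m → ℝ) (D : Fin n → ℝ) (B : Fin m → ℝ),
      (∀ i, deg (g i) = 1 → D i = 0) ∧ (∀ j, deg (f j) = 1 → B j = 0) ∧
      (∀ i j, deg (g i) = 1 ∨ deg (f j) = 1 → κ i j = 0) ∧
      ∀ i j, j ∈ dep (g i) → 2 ≤ deg (g i) → 2 ≤ deg (f j) →
        (∀ y : Fin m → ℝ, y j = -κ i j → multilinearExt (g i) y = D i) ∧
        ∀ x : Fin n → ℝ, x i = -κ i j → multilinearExt (f j) x = B j := by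
  classical
  have hex : ∀ i j, ∃ K D E : ℝ, j ∈ dep (g i) ∧ 2 ≤ deg (g i) ∧ 2 ≤ deg (f j) →
      (∀ y : Fin m → ℝ, y j = -K → multilinearExt (g i) y = D) ∧
        ∀ x : Fin n → ℝ, x i = -K → multilinearExt (f j) x = E := by
    intro i j
    by_cases hc : j ∈ dep (g i) ∧ 2 ≤ deg (g i) ∧ 2 ≤ deg (f j)
    · have hij := (h.mem_dep_iff hf₀ hg₀ (fun j => (hf j).2) (fun i => (hg i).2) i j).1 hc.1
      obtain ⟨K, D, E, hK⟩ := h.exists_hyperplane (fun i => (hg i).2)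
        (show i ∈ dep f₀ by simp [hf₀]) ((hg i).1.slopeAt_nonconstant hc.2.1 hc.1)
        ((hf j).1.slopeAt_nonconstant hc.2.2 hij)
      exact ⟨K, D, E, fun _ => hK⟩
    · exact ⟨0, 0, 0, fun hc' => absurd hc' hc⟩
  choose K D E hK using hex
  refine ⟨fun i j => if deg (g i) = 1 ∨ deg (f j) = 1 then 0 else K i j,
    fun i => if hi : ∃ j, j ∈ dep (g i) ∧ 2 ≤ deg (g i) ∧ 2 ≤ deg (f j) then D i hi.choose else 0,
    fun j => if hj : ∃ i, j ∈ dep (g i) ∧ 2 ≤ deg (g i) ∧ 2 ≤ deg (f j) then E hj.choose j else 0,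
    ?_, ?_, fun i j hij => if_pos hij, ?_⟩
  · intro i hi
    exact dif_neg fun ⟨j, hj⟩ => by omega
  · intro j hj
    exact dif_neg fun ⟨i, hi⟩ => by omega
  · intro i j hij hi hj
    have hn : ¬ (deg (g i) = 1 ∨ deg (f j) = 1) := by omega
    have hij' := hK i j ⟨hij, hi, hj⟩
    have hDe : ∃ j, j ∈ dep (g i) ∧ 2 ≤ deg (g i) ∧ 2 ≤ deg (f j) := ⟨j, hij, hi, hj⟩
    have hBe : ∃ i, j ∈ dep (g i) ∧ 2 ≤ deg (g i) ∧ 2 ≤ deg (f j) := ⟨i, hij, hi, hj⟩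
    -- The hyperplanes for two different columns meet, so g_i has the same constant value on both.
    have hD' : D i hDe.choose = D i j := by
      by_cases he : hDe.choose = j
      · rw [he]
      · rw [← (hK i _ hDe.choose_spec).1 (Function.update (fun _ => -K i hDe.choose) j (-K i j))
          (by rw [Function.update_of_ne he]), hij'.1 _ (Function.update_self _ _ _)]
    have hB' : E hBe.choose j = E i j := by
      by_cases he : hBe.choose = i
      · rw [he]
      · rw [← (hK _ j hBe.choose_spec).2 (Function.update (fun _ => -K hBe.choose j) i (-K i j))
          (by rw [Function.update_of_ne he]), hij'.2 _ (Function.update_self _ _ _)]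
    dsimp only
    rw [if_neg hn, dif_pos hDe, dif_pos hBe, hD', hB']
    exact hij'

/-- The formula for `g_i` (and for `f_j`), given the hyperplanes on which it is constant. -/
theorem apply_eq_prod_mul_add (v : Fin m → Cube (Fin n) → ℝ) (q : Cube (Fin m) → ℝ)
    (hv : ∀ j, deg (v j) = 1 ∨ 2 ≤ deg (v j)) (c : Fin m → ℝ) (D : ℝ)
    (hq : ∀ j ∈ degTwo v (dep q), ∀ y : Fin m → ℝ, y j = -c j → multilinearExt q y = D) :
    ∃ γ : Cube (degOne v (dep q)) → ℝ, ∀ y : Cube (Fin m),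
      q y = (∏ j ∈ degTwo v (dep q), (toReal (y j) + c j)) * γ (fun j => y j) + D := by
  classical
  -- γ is q - D at the point whose heavy coordinates are 1 - c_j, where all linear factors equal 1.
  -- Irrelevant coordinates receive the same default without effect.
  refine ⟨fun w => multilinearExt q (fun j => if hj : j ∈ degOne v (dep q) then toReal (w ⟨j, hj⟩)
    else 1 - c j) - D, fun y => ?_⟩
  have h1 := ((isMultiaffine_multilinearExt q).sub (isMultiaffine_const D)).eq_prod_mul c
    (degTwo v (dep q)) (fun j hj y hy => by rw [hq j hj y hy, sub_self]) fun j => toReal (y j)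
  rw [multilinearExt_toReal, sub_eq_iff_eq_add] at h1
  rw [h1]
  congr 3
  refine dependsOn_multilinearExt q fun j hj => ?_
  have hj' : j ∈ dep q := by simpa using hj
  rcases hv j with h2 | h2
  · have h3 : j ∉ degTwo v (dep q) := fun h => by
      have := (mem_degTwo.1 h).2
      omega
    rw [if_neg h3, dif_pos (mem_degOne.2 ⟨hj', h2⟩)]
  · have h3 : j ∉ degOne v (dep q) := fun h => by
      have := (mem_degOne.1 h).2
      omega
    rw [if_pos (mem_degTwo.2 ⟨hj', h2⟩), dif_neg h3]

end Composition

end GenPoly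

namespace GenPoly

/-! ### Affine dependence on each block function -/

section Direct

variable {n m : ℕ} {f₀ : Cube (Fin n) → ℝ} {f : Fin m → Cube (Fin n) → ℝ}
  {g₀ : Cube (Fin m) → ℝ} {g : Fin n → Cube (Fin m) → ℝ}

theorem dependsOn_rowVals (g : Fin n → Cube (Fin m) → ℝ) (i : Fin n) :
    DependsOn (fun Z => rowVals g Z i) {p | p.1 = i ∧ p.2 ∈ dep (g i)} :=
  fun _ _ hZ => dependsOn_multilinearExt (g i) fun j hj => hZ (i, j) ⟨rfl, by simpa using hj⟩

theorem dependsOn_comp_rowVals {P : (Fin n → ℝ) → ℝ} {i : Fin n}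
    (hP : ∀ x t, P (Function.update x i t) = P x) (g : Fin n → Cube (Fin m) → ℝ) :
    DependsOn (fun Z => P (rowVals g Z)) {p | p.1 ≠ i} := by
  intro Z Z' hZ
  dsimp only
  rw [← hP (rowVals g Z') (rowVals g Z i)]
  congr 1
  funext k
  by_cases h : k = i
  · subst h; simp
  · rw [Function.update_of_ne h]
    exact congrArg (multilinearExt (g k)) (funext fun j => hZ (k, j) h)

theorem dependsOn_comp_colVals {P : (Fin m → ℝ) → ℝ} {j : Fin m}
    (hP : ∀ y t, P (Function.update y j t) = P y) (f : Fin m → Cube (Fin n) → ℝ) :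
    DependsOn (fun Z => P (colVals f Z)) {p | p.2 ≠ j} := fun Z Z' hZ =>
  dependsOn_comp_rowVals hP f (x := fun p => Z p.swap) (y := fun p => Z' p.swap)
    fun p hp => hZ p.swap hp

/-- Setting the single entry z_ij to -K freezes g_i at D and f_j at B simultaneously. -/
theorem IsGenPolymorphism.subst_eq (h : IsGenPolymorphism f₀ f g₀ g) {i : Fin n} {j : Fin m}
    {K D B : ℝ} (hD : ∀ y : Fin m → ℝ, y j = -K → multilinearExt (g i) y = D)
    (hB : ∀ x : Fin n → ℝ, x i = -K → multilinearExt (f j) x = B) (Z : Fin n × Fin m → ℝ) :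
    multilinearExt f₀ (Function.update (rowVals g Z) i D) =
      multilinearExt g₀ (Function.update (colVals f Z) j B) := by
  have := h.real_eq (Function.update Z (i, j) (-K))
  rwa [rowVals_update, colVals_update, hD _ (Function.update_self _ _ _),
    hB _ (Function.update_self _ _ _)] at this

namespace Params

variable {d : Params f g}

/-- In a block with at least two entries, no entry has both its row and its column of degree `1`. -/
theorem two_le_deg_or (hd : d.IsBlockPartition) (hconn : d.IsConnected)
    (hZ₀ : ∀ i j, (i, j) ∈ d.Z₀ ↔ j ∈ dep (g i))
    (hf : ∀ j, IsSignedInput (f j) ∨ 2 ≤ deg (f j)) (hg : ∀ i, IsSignedInput (g i) ∨ 2 ≤ deg (g i))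
    {ℓ : Fin d.k} (hℓ : 1 < (d.Z ℓ).card) {p : Fin n × Fin m} (hp : p ∈ d.Z ℓ) :
    2 ≤ deg (g p.1) ∨ 2 ≤ deg (f p.2) := by
  by_contra hcon
  rw [not_or] at hcon
  have hg1 := (hg p.1).resolve_right hcon.1
  have hf1 := (hf p.2).resolve_right hcon.2
  have hmem : ∀ q ∈ d.Z ℓ, q.2 ∈ dep (g q.1) ∧ q.1 ∈ dep (f q.2) := by
    intro q hq
    have h1 := (hZ₀ q.1 q.2).1 (hd.mem_Z₀.2 ⟨ℓ, hq⟩)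
    exact ⟨h1, (hd.dep_iff ℓ q.1 (mem_rows.2 ⟨_, hq⟩) q.2 (mem_cols.2 ⟨_, hq⟩)).1 h1⟩
  -- A doubly light entry is the only relevant one in its row and in its column, so no path leaves
  -- it.
  have hall : ∀ q, Relation.ReflTransGen
      (fun a b => b ∈ d.Z ℓ ∧ (a.1 = b.1 ∨ a.2 = b.2)) p q → q = p := by
    intro q hq
    induction hq with
    | refl => rfl
    | @tail a b _ hab ih =>
      subst ih
      obtain ⟨hb, h1 | h1⟩ := hab
      · have h2 := (hmem b hb).1
        rw [← h1, hg1.dep_eq (hmem a hp).1, Finset.mem_singleton] at h2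
        exact Prod.ext h1.symm h2
      · have h2 := (hmem b hb).2
        rw [← h1, hf1.dep_eq (hmem a hp).2, Finset.mem_singleton] at h2
        exact Prod.ext h2 h1.symm
  obtain ⟨q, hq, hqp⟩ := Finset.exists_mem_ne hℓ p
  exact hqp (hall q (hconn ℓ p hp q hq))

/-- The restrictions `f₀|_{x_i = D_i} ∘ g` and `g₀|_{y_j = B_j} ∘ f` agree for all rows and columns of
a block of degree at least `2`, and do not depend on the entries of the block. -/
theorem exists_common_restriction (h : IsGenPolymorphism f₀ f g₀ g) (hd : d.IsBlockPartition)
    (hconn : d.IsConnected) (hZ₀ : ∀ i j, (i, j) ∈ d.Z₀ ↔ j ∈ dep (g i))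
    (hf : ∀ j, IsSignedInput (f j) ∨ 2 ≤ deg (f j)) (hg : ∀ i, IsSignedInput (g i) ∨ 2 ≤ deg (g i))
    (hκ : ∀ i j, j ∈ dep (g i) → 2 ≤ deg (g i) → 2 ≤ deg (f j) →
      (∀ y : Fin m → ℝ, y j = -d.κ i j → multilinearExt (g i) y = d.D i) ∧
        ∀ x : Fin n → ℝ, x i = -d.κ i j → multilinearExt (f j) x = d.B j)
    {ℓ : Fin d.k} (hℓ : 1 < (d.Z ℓ).card) :
    ∃ Q : (Fin n × Fin m → ℝ) → ℝ, DependsOn Q (d.Z ℓ : Set (Fin n × Fin m))ᶜ ∧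
      (∀ i ∈ degTwo g (rows (d.Z ℓ)), ∀ Z,
        Q Z = multilinearExt f₀ (Function.update (rowVals g Z) i (d.D i))) ∧
      ∀ j ∈ degTwo f (cols (d.Z ℓ)), ∀ Z,
        Q Z = multilinearExt g₀ (Function.update (colVals f Z) j (d.B j)) := by
  obtain ⟨e, he⟩ := hd.nonempty ℓ
  have hmem : ∀ q ∈ d.Z ℓ, q.2 ∈ dep (g q.1) ∧ q.1 ∈ dep (f q.2) := by
    intro q hq
    have h1 := (hZ₀ q.1 q.2).1 (hd.mem_Z₀.2 ⟨ℓ, hq⟩)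
    exact ⟨h1, (hd.dep_iff ℓ q.1 (mem_rows.2 ⟨_, hq⟩) q.2 (mem_cols.2 ⟨_, hq⟩)).1 h1⟩
  have hor := fun p hp => two_le_deg_or hd hconn hZ₀ hf hg hℓ (p := p) hp
  have hFG : ∀ p ∈ d.Z ℓ, 2 ≤ deg (g p.1) → 2 ≤ deg (f p.2) → ∀ Z,
      multilinearExt f₀ (Function.update (rowVals g Z) p.1 (d.D p.1)) =
        multilinearExt g₀ (Function.update (colVals f Z) p.2 (d.B p.2)) := by
    intro p hp h1 h2
    obtain ⟨h3, h4⟩ := hκ p.1 p.2 (hmem p hp).1 h1 h2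
    exact h.subst_eq h3 h4
  have hex : ∃ Q : (Fin n × Fin m → ℝ) → ℝ,
      (2 ≤ deg (g e.1) → ∀ Z,
        Q Z = multilinearExt f₀ (Function.update (rowVals g Z) e.1 (d.D e.1))) ∧
      (2 ≤ deg (f e.2) → ∀ Z,
        Q Z = multilinearExt g₀ (Function.update (colVals f Z) e.2 (d.B e.2))) := by
    by_cases h1 : 2 ≤ deg (g e.1)
    · exact ⟨_, fun _ _ => rfl, fun h2 => hFG e he h1 h2⟩
    · exact ⟨_, fun h2 => absurd h2 h1, fun _ _ => rfl⟩
  obtain ⟨Q, hQe⟩ := hex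
  -- Induction along a path: a step within a heavy row or column keeps the restriction of that line
  -- and passes it to the crossing line if that is heavy too. A light line has only one relevant
  -- entry, so a step along it stays put.
  have hQ : ∀ p ∈ d.Z ℓ, (2 ≤ deg (g p.1) → ∀ Z,
        Q Z = multilinearExt f₀ (Function.update (rowVals g Z) p.1 (d.D p.1))) ∧
      (2 ≤ deg (f p.2) → ∀ Z,
        Q Z = multilinearExt g₀ (Function.update (colVals f Z) p.2 (d.B p.2))) := by
    intro p hp
    have hr := hconn ℓ e he p hp
    clear hp
    suffices hs : p ∈ d.Z ℓ ∧ _ from hs.2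
    induction hr with
    | refl => exact ⟨he, hQe⟩
    | @tail a b _ hab ih =>
      obtain ⟨ha, iha1, iha2⟩ := ih
      obtain ⟨hb, h1 | h1⟩ := hab
      · refine ⟨hb, ?_⟩
        by_cases h2 : 2 ≤ deg (g b.1)
        · have h3 := iha1 (h1 ▸ h2)
          rw [h1] at h3
          exact ⟨fun _ => h3, fun h4 Z => by rw [h3, hFG b hb h2 h4]⟩
        · have h3 := (hmem b hb).1
          have h4 := ((hg b.1).resolve_right h2).dep_eq (h1 ▸ (hmem a ha).1)
          rw [h4, Finset.mem_singleton] at h3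
          have : b = a := Prod.ext h1.symm h3
          subst this
          exact ⟨iha1, iha2⟩
      · refine ⟨hb, ?_⟩
        by_cases h2 : 2 ≤ deg (f b.2)
        · have h3 := iha2 (h1 ▸ h2)
          rw [h1] at h3
          exact ⟨fun h4 Z => by rw [h3, hFG b hb h4 h2], fun _ => h3⟩
        · have h3 := (hmem b hb).2
          have h4 := ((hf b.2).resolve_right h2).dep_eq (h1 ▸ (hmem a ha).2)
          rw [h4, Finset.mem_singleton] at h3
          have : b = a := Prod.ext h3 h1.symm
          subst this
          exact ⟨iha1, iha2⟩
  refine ⟨Q, dependsOn_of_update fun p hp Z t => ?_, fun i hi => ?_, fun j hj => ?_⟩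
  -- Each entry of the block lies on a heavy line, and freezing the function of that line removes
  -- the entry from Q.
  · have hp' : p ∈ d.Z ℓ := by simpa using hp
    rcases hor p hp' with h1 | h1
    · rw [(hQ p hp').1 h1, (hQ p hp').1 h1, show p = (p.1, p.2) from rfl, rowVals_update,
        Function.update_idem]
    · rw [(hQ p hp').2 h1, (hQ p hp').2 h1, show p = (p.1, p.2) from rfl, colVals_update,
        Function.update_idem]
  · obtain ⟨j, hj⟩ := mem_rows.1 (mem_degTwo.1 hi).1
    exact (hQ (i, j) hj).1 (mem_degTwo.1 hi).2
  · obtain ⟨i, hi⟩ := mem_cols.1 (mem_degTwo.1 hj).1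
    exact (hQ (i, j) hi).2 (mem_degTwo.1 hj).2

/-- The composition `f₀ ∘ g` is affine in each block function. -/
theorem exists_affine_in_block (h : IsGenPolymorphism f₀ f g₀ g) (hd : d.IsBlockPartition)
    (hconn : d.IsConnected) (hZ₀ : ∀ i j, (i, j) ∈ d.Z₀ ↔ j ∈ dep (g i))
    (hfn : ∀ j, NonConstant (f j)) (hgn : ∀ i, NonConstant (g i))
    (hf : ∀ j, IsSignedInput (f j) ∨ 2 ≤ deg (f j)) (hg : ∀ i, IsSignedInput (g i) ∨ 2 ≤ deg (g i))
    (hκ : ∀ i j, j ∈ dep (g i) → 2 ≤ deg (g i) → 2 ≤ deg (f j) →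
      (∀ y : Fin m → ℝ, y j = -d.κ i j → multilinearExt (g i) y = d.D i) ∧
        ∀ x : Fin n → ℝ, x i = -d.κ i j → multilinearExt (f j) x = d.B j)
    (hfeq : ∀ j x, f j x =
      (∏ i ∈ degTwo g (dep (f j)), (toReal (x i) + d.κ i j)) * d.φ j (fun i => x i) + d.B j)
    (ℓ : Fin d.k) :
    ∃ c Q : (Fin n × Fin m → ℝ) → ℝ, DependsOn c (d.Z ℓ : Set (Fin n × Fin m))ᶜ ∧
      DependsOn Q (d.Z ℓ : Set (Fin n × Fin m))ᶜ ∧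
      ∀ Z, multilinearExt f₀ (rowVals g Z) = c Z * d.realBlock ℓ (rowVals g Z) + Q Z := by
  have hP := isMultiaffine_multilinearExt f₀
  by_cases hℓ : 1 < (d.Z ℓ).card
  · obtain ⟨Q, hQd, hQf, hQg⟩ := exists_common_restriction h hd hconn hZ₀ hf hg hκ hℓ
    have hcolf : ∀ j (Z : Fin n × Fin m → ℝ), colVals f Z j - d.B j =
        (∏ i ∈ degTwo g (dep (f j)), (Z (i, j) + d.κ i j)) *
          multilinearExt (d.φ j) fun i => Z (i, j) := by
      intro j Z
      have := multilinearExt_g_eq (d := d.swap) (i := j) (hfeq j) fun i => Z (i, j)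
      rw [colVals, this]
      exact add_sub_cancel_right _ _
    -- One factor g_i - D_i per heavy row, with variables in row i, and one factor φ_j per heavy
    -- column, with variables the relevant entries of column j in light rows. These variable sets
    -- are disjoint.
    obtain ⟨T, hT, hFT⟩ := exists_eq_prod_mul
      ((degTwo g (rows (d.Z ℓ))).disjSum (degTwo f (cols (d.Z ℓ))))
      (Sum.elim (fun i => {p : Fin n × Fin m | p.1 = i})
        fun j => {p : Fin n × Fin m | p.1 ∈ degOne g (dep (f j)) ∧ p.2 = j})
      (by
        rintro (i | j) hs (i' | j') ht hne
        · exact Set.disjoint_left.2 fun p hp hp' => hne (congrArg Sum.inl (hp.symm.trans hp'))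
        · refine Set.disjoint_left.2 fun p hp hp' => ?_
          have h1 := (mem_degTwo.1 (Finset.inl_mem_disjSum.1 hs)).2
          have h2 := (mem_degOne.1 hp'.1).2
          have h3 : p.1 = i := hp
          rw [h3] at h2
          omega
        · refine Set.disjoint_left.2 fun p hp' hp => ?_
          have h1 := (mem_degTwo.1 (Finset.inl_mem_disjSum.1 ht)).2
          have h2 := (mem_degOne.1 hp'.1).2
          have h3 : p.1 = i' := hp
          rw [h3] at h2
          omega
        · exact Set.disjoint_left.2 fun p hp hp' =>
            hne (congrArg Sum.inr (hp.2.symm.trans hp'.2)))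
      (Sum.elim (fun i Z => rowVals g Z i - d.D i)
        fun j Z => multilinearExt (d.φ j) fun i => Z (i, j))
      (by
        rintro (i | j) hs Z Z' hZ
        · exact congrArg (· - d.D i) (dependsOn_rowVals g i fun p hp => hZ p hp.1)
        · exact congrArg (multilinearExt (d.φ j)) (funext fun i => hZ (i.1, j) ⟨i.2, rfl⟩))
      (by
        rintro (i | j) hs
        · by_contra! h0
          obtain ⟨x, y, hxy⟩ := hgn i
          have hc : ∀ x : Cube (Fin m), g i x = d.D i := fun x => by
            have := sub_eq_zero.1 (h0 fun p => toReal (x p.2))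
            rwa [rowVals, multilinearExt_toReal] at this
          exact hxy (by rw [hc, hc])
        · by_contra! h0
          obtain ⟨x, y, hxy⟩ := hfn j
          have hc : ∀ x : Cube (Fin n), f j x = d.B j := fun x => by
            have h1 : multilinearExt (d.φ j) (fun i => toReal (x i)) = 0 :=
              h0 fun p => toReal (x p.1)
            rw [multilinearExt_toReal (d.φ j) fun i => x i] at h1
            rw [hfeq, h1, mul_zero, zero_add]
          exact hxy (by rw [hc, hc]))
      (fun Z => multilinearExt f₀ (rowVals g Z) - Q Z)
      -- F - Q is g_i - D_i times the slope of f₀ in direction i, which is free of row i. It is also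
      -- f_j - B_j times a slope of g₀ free of column j; the linear factors of f_j - B_j lie in
      -- heavy rows and join the quotient, leaving φ_j.
      (by
        rintro (i | j) hs
        · refine ⟨fun Z => slopeAt (multilinearExt f₀) i (rowVals g Z), ?_, fun Z => ?_⟩
          · exact dependsOn_comp_rowVals (slopeAt_update _ i) g
          · rw [hQf i (Finset.inl_mem_disjSum.1 hs), hP.eq_update _ i (d.D i)]
            exact add_sub_cancel_left _ _
        · refine ⟨fun Z => (∏ i ∈ degTwo g (dep (f j)), (Z (i, j) + d.κ i j)) *
            slopeAt (multilinearExt g₀) j (colVals f Z), fun Z Z' hZ => ?_, fun Z => ?_⟩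
          · dsimp only
            congr 1
            · refine Finset.prod_congr rfl fun i hi => ?_
              rw [hZ (i, j)]
              rintro ⟨h1, -⟩
              have h1 := (mem_degOne.1 h1).2
              have h2 := (mem_degTwo.1 hi).2
              dsimp only at h1
              omega
            · exact dependsOn_comp_colVals (slopeAt_update _ j) f fun p hp =>
                hZ p fun hp' => hp hp'.2
          · rw [hQg j (Finset.inr_mem_disjSum.1 hs), h.real_eq,
              (isMultiaffine_multilinearExt g₀).eq_update _ j (d.B j), hcolf, Sum.elim_inr]
            ring)
    -- The variable sets cover the block, because a light row can meet it only in heavy columns.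
    refine ⟨T, Q, hT.mono ?_, hQd, fun Z => ?_⟩
    · rw [Set.compl_subset_compl]
      intro p hp
      have hp' : p ∈ d.Z ℓ := hp
      have hr : p.1 ∈ rows (d.Z ℓ) := mem_rows.2 ⟨p.2, hp'⟩
      have hc : p.2 ∈ cols (d.Z ℓ) := mem_cols.2 ⟨p.1, hp'⟩
      rw [Set.mem_iUnion₂]
      rcases hg p.1 with h1 | h1
      · have h2 : 2 ≤ deg (f p.2) := by
          have := two_le_deg_or hd hconn hZ₀ hf hg hℓ hp'
          have := h1.deg_eq_one
          omega
        have h3 : p.1 ∈ dep (f p.2) :=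
          (hd.dep_iff ℓ _ hr _ hc).1 ((hZ₀ _ _).1 (hd.mem_Z₀.2 ⟨ℓ, hp'⟩))
        exact ⟨Sum.inr p.2, Finset.inr_mem_disjSum.2 (mem_degTwo.2 ⟨hc, h2⟩),
          mem_degOne.2 ⟨h3, h1.deg_eq_one⟩, rfl⟩
      · exact ⟨Sum.inl p.1, Finset.inl_mem_disjSum.2 (mem_degTwo.2 ⟨hr, h1⟩), rfl⟩
    · have h1 := hFT Z
      rw [Finset.prod_disjSum] at h1
      simp only [Sum.elim_inl, Sum.elim_inr] at h1
      rw [realBlock_rowVals hd (fun i _ => hg i) hℓ]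
      linear_combination h1
  · obtain ⟨⟨i, j⟩, hp⟩ := Finset.card_eq_one.1
      (le_antisymm (not_lt.1 hℓ) (Finset.card_pos.2 (hd.nonempty ℓ)))
    have hF := hP.comp_rowVals g
    have hni : (i, j) ∉ ((d.Z ℓ : Set (Fin n × Fin m)))ᶜ := by simp [hp]
    -- The block value is sgn(f_j) sgn(g_i) z_ij, so the coefficient of z_ij carries both signs,
    -- whose squares are 1.
    refine ⟨fun Z => toReal (sgn (f j)) * toReal (sgn (g i)) *
      slopeAt (fun Z => multilinearExt f₀ (rowVals g Z)) (i, j) Z,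
      fun Z => multilinearExt f₀ (rowVals g (Function.update Z (i, j) 0)), ?_, ?_, fun Z => ?_⟩
    · refine dependsOn_of_update fun p hp' Z t => ?_
      have : p = (i, j) := by simpa [hp] using hp'
      rw [this, slopeAt_update]
    · refine dependsOn_of_update fun p hp' Z t => ?_
      have : p = (i, j) := by simpa [hp] using hp'
      rw [this, Function.update_idem]
    · rw [realBlock, if_neg hℓ, hp, Finset.prod_singleton]
      dsimp only
      rw [hF.eq_update Z (i, j) 0, rowVals, hd.multilinearExt_of_singleton (fun i _ => hg i) hp]
      linear_combination (-(toReal (sgn (f j)) * toReal (sgn (f j))) *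
        slopeAt (fun Z => multilinearExt f₀ (rowVals g Z)) (i, j) Z * Z (i, j)) *
        toReal_mul_self (sgn (g i)) -
        slopeAt (fun Z => multilinearExt f₀ (rowVals g Z)) (i, j) Z * Z (i, j) *
        toReal_mul_self (sgn (f j))

end Params

end Direct

end GenPoly

namespace GenPoly

/-! ### Recovering f₀ and g₀, and assembling the data -/

section Main

variable {n m : ℕ} {f₀ : Cube (Fin n) → ℝ} {f : Fin m → Cube (Fin n) → ℝ}
  {g₀ : Cube (Fin m) → ℝ} {g : Fin n → Cube (Fin m) → ℝ}

/-- The function h is found for the composition over the matrix. Cancelling the g_i gives f₀;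
rewriting the block values through the columns and cancelling the f_j gives g₀ with the same h. -/
theorem Params.exists_h {d : Params f g} (h : IsGenPolymorphism f₀ f g₀ g)
    (hd : d.IsBlockPartition) (hconn : d.IsConnected) (hdep : d.Z₀ = dep (rowComp f₀ g))
    (hZ₀ : ∀ i j, (i, j) ∈ d.Z₀ ↔ j ∈ dep (g i))
    (hfn : ∀ j, NonConstant (f j)) (hgn : ∀ i, NonConstant (g i))
    (hf : ∀ j, IsSignedInput (f j) ∨ 2 ≤ deg (f j)) (hg : ∀ i, IsSignedInput (g i) ∨ 2 ≤ deg (g i))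
    (hκ : ∀ i j, j ∈ dep (g i) → 2 ≤ deg (g i) → 2 ≤ deg (f j) →
      (∀ y : Fin m → ℝ, y j = -d.κ i j → multilinearExt (g i) y = d.D i) ∧
        ∀ x : Fin n → ℝ, x i = -d.κ i j → multilinearExt (f j) x = d.B j)
    (hfeq : ∀ j x, f j x =
      (∏ i ∈ degTwo g (dep (f j)), (toReal (x i) + d.κ i j)) * d.φ j (fun i => x i) + d.B j)
    (hgeq : ∀ i y, g i y =
      (∏ j ∈ degTwo f (dep (g i)), (toReal (y j) + d.κ i j)) * d.γ i (fun j => y j) + d.D i) :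
    ∃ H : Cube (Fin d.k) → ℝ, dep H = Finset.univ ∧
      (∀ x, f₀ x = multilinearExt H fun ℓ => d.f₀Block ℓ x) ∧
      ∀ y, g₀ y = multilinearExt H fun ℓ => d.g₀Block ℓ y := by
  have hrow : ∀ ℓ, ∀ i ∈ rows (d.Z ℓ), ∀ j ∈ dep (g i), (i, j) ∈ d.Z ℓ := by
    intro ℓ i hi j hj
    obtain ⟨ℓ', hℓ'⟩ := hd.mem_Z₀.1 ((hZ₀ i j).2 hj)
    by_cases he : ℓ = ℓ'
    · rwa [he]
    · exact (Finset.disjoint_left.1 (hd.rows_disjoint _ _ he) hi (mem_rows.2 ⟨j, hℓ'⟩)).elim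
  obtain ⟨H, hH, hF⟩ := exists_multilinearExt_comp_eq
    ((isMultiaffine_multilinearExt f₀).comp_rowVals g)
    (V := fun ℓ => (d.Z ℓ : Set (Fin n × Fin m)))
    (M := fun ℓ Z => d.realBlock ℓ (rowVals g Z))
    (fun a b hab => Set.disjoint_left.2 fun p hp hp' =>
      Finset.disjoint_left.1 (hd.rows_disjoint a b hab) (mem_rows.2 ⟨p.2, hp⟩)
        (mem_rows.2 ⟨p.2, hp'⟩))
    (by
      rw [← multilinearExt_rowComp]
      refine (dependsOn_multilinearExt _).mono fun p hp => ?_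
      rw [← hdep] at hp
      exact Set.mem_iUnion.2 (hd.mem_Z₀.1 hp))
    (fun ℓ => (isMultiaffine_realBlock hd (fun i _ => hg i) ℓ).comp_rowVals g)
    (fun ℓ Z Z' hZ => dependsOn_realBlock hd ℓ fun i hi =>
      dependsOn_rowVals g i fun p ⟨h1, h2⟩ =>
        hZ p (by subst h1; exact hrow ℓ p.1 (by simpa using hi) p.2 h2))
    (exists_affine_in_block h hd hconn hZ₀ hfn hgn hf hg hκ hfeq)
    (fun ℓ => by
      obtain ⟨p, hp⟩ := hd.nonempty ℓ
      refine ⟨p, hp, ?_⟩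
      rw [← multilinearExt_rowComp]
      exact exists_slopeAt_ne_zero (hdep ▸ hd.mem_Z₀.2 ⟨ℓ, hp⟩))
  let d' : Params f g := { d with h := H }
  have hd' : d'.IsBlockPartition := ⟨hd.nonempty, hd.union, hd.rows_disjoint, hd.cols_disjoint,
    hd.dep_row, hd.dep_col, hd.dep_iff⟩
  have hx : multilinearExt f₀ = fun x => multilinearExt H fun ℓ => d.realBlock ℓ x :=
    (isMultiaffine_multilinearExt f₀).eq_of_rowVals
      (isMultiaffine_h_realBlock hd' fun i _ => hg i) hgn hF
  have hy : multilinearExt g₀ = fun y => multilinearExt H fun ℓ => d.swap.realBlock ℓ y :=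
    (isMultiaffine_multilinearExt g₀).eq_of_colVals
      (isMultiaffine_h_realBlock hd'.swap fun j _ => hf j) hfn fun Z => by
        have e : ∀ ℓ, d.swap.realBlock ℓ (colVals f Z) = d.realBlock ℓ (rowVals g Z) := fun ℓ =>
          (realBlock_rowVals_eq hd (fun j _ => hf j) (fun i _ => hg i) (fun j _ => hfeq j)
            (fun i _ => hgeq i) ℓ Z).symm
        rw [← h.real_eq, hF Z]
        exact congrArg (multilinearExt H) (funext fun ℓ => (e ℓ).symm)
  refine ⟨H, hH, fun x => ?_, fun y => ?_⟩
  · rw [← multilinearExt_toReal f₀, hx]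
    simp only [realBlock_toReal]
  · rw [← multilinearExt_toReal g₀, hy]
    simp only [realBlock_swap_toReal]

theorem IsGenPolymorphism.exists_params (h : IsGenPolymorphism f₀ f g₀ g)
    (hf₀ : dep f₀ = Finset.univ) (hg₀ : dep g₀ = Finset.univ)
    (hf : ∀ j, IsBooleanLike (f j) ∧ NonConstant (f j))
    (hg : ∀ i, IsBooleanLike (g i) ∧ NonConstant (g i)) :
    ∃ d : Params f g,
      d.Z₀ = dep (rowComp f₀ g) ∧ rows d.Z₀ = Finset.univ ∧ cols d.Z₀ = Finset.univ ∧
      d.IsBlockPartition ∧ d.IsConnected ∧ d.IsNormalized ∧ d.Represents f₀ g₀ := by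
  have hfn := fun j => (hf j).2
  have hgn := fun i => (hg i).2
  have hf' := fun j => (hf j).1.isSignedInput_or (hfn j)
  have hg' := fun i => (hg i).1.isSignedInput_or (hgn i)
  have hfd : ∀ j, deg (f j) = 1 ∨ 2 ≤ deg (f j) := fun j =>
    (hf' j).imp_left fun h => h.deg_eq_one
  have hgd : ∀ i, deg (g i) = 1 ∨ 2 ≤ deg (g i) := fun i =>
    (hg' i).imp_left fun h => h.deg_eq_one
  have hiff := h.mem_dep_iff hf₀ hg₀ hfn hgn
  have hZ₀ := mem_dep_rowComp hf₀ hgn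
  obtain ⟨κ, D, B, hD, hB, hκ0, hκ⟩ := h.exists_constants hf₀ hg₀ hf hg
  have hγ : ∀ i, ∃ γ : Cube (degOne f (dep (g i))) → ℝ, ∀ y, g i y =
      (∏ j ∈ degTwo f (dep (g i)), (toReal (y j) + κ i j)) * γ (fun j => y j) + D i := by
    refine fun i => apply_eq_prod_mul_add f (g i) hfd (κ i) (D i) fun j hj y hy => ?_
    obtain ⟨hj1, hj2⟩ := mem_degTwo.1 hj
    rcases hg' i with h1 | h1
    -- A light g_i is ± y_j, which vanishes on y_j = 0, in accordance with κ_ij = 0 and D_i = 0.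
    · rw [h1.multilinearExt_eq hj1, hy, hκ0 i j (Or.inl h1.deg_eq_one), hD i h1.deg_eq_one]
      simp
    · exact (hκ i j hj1 h1 hj2).1 y hy
  have hφ : ∀ j, ∃ φ : Cube (degOne g (dep (f j))) → ℝ, ∀ x, f j x =
      (∏ i ∈ degTwo g (dep (f j)), (toReal (x i) + κ i j)) * φ (fun i => x i) + B j := by
    refine fun j => apply_eq_prod_mul_add g (f j) hgd (fun i => κ i j) (B j) fun i hi x hx => ?_
    obtain ⟨hi1, hi2⟩ := mem_degTwo.1 hi
    rcases hf' j with h1 | h1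
    · rw [h1.multilinearExt_eq hi1, hx, hκ0 i j (Or.inr h1.deg_eq_one), hB j h1.deg_eq_one]
      simp
    · exact (hκ i j ((hiff i j).2 hi1) hi2 h1).2 x hx
  choose γ hγ using hγ
  choose φ hφ using hφ
  obtain ⟨k, Z, hne, hun, hadj, hconn⟩ := exists_components (dep (rowComp f₀ g))
  have hmem : ∀ i j, j ∈ dep (g i) → ∃ ℓ, (i, j) ∈ Z ℓ := fun i j hj => by
    have := (hZ₀ i j).2 hj
    rw [hun] at this
    simpa using this
  have hpart : ∀ H, Params.IsBlockPartition
      (⟨dep (rowComp f₀ g), k, Z, H, φ, γ, B, D, κ⟩ : Params f g) := fun H =>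
    { nonempty := hne
      union := hun
      rows_disjoint := fun ℓ ℓ' hne => Finset.disjoint_left.2 fun i hi hi' => by
        obtain ⟨j, hj⟩ := mem_rows.1 hi
        obtain ⟨j', hj'⟩ := mem_rows.1 hi'
        exact hne (hadj ℓ ℓ' _ hj _ hj' (Or.inl rfl))
      cols_disjoint := fun ℓ ℓ' hne => Finset.disjoint_left.2 fun j hj hj' => by
        obtain ⟨i, hi⟩ := mem_cols.1 hj
        obtain ⟨i', hi'⟩ := mem_cols.1 hj'
        exact hne (hadj ℓ ℓ' _ hi _ hi' (Or.inr rfl))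
      dep_row := fun ℓ i hi j hj => by
        obtain ⟨j', hj'⟩ := mem_rows.1 hi
        obtain ⟨ℓ', hℓ'⟩ := hmem i j hj
        have := hadj ℓ ℓ' _ hj' _ hℓ' (Or.inl rfl)
        subst this
        exact mem_cols.2 ⟨i, hℓ'⟩
      dep_col := fun ℓ j hj i hi => by
        obtain ⟨i', hi'⟩ := mem_cols.1 hj
        obtain ⟨ℓ', hℓ'⟩ := hmem i j ((hiff i j).2 hi)
        have := hadj ℓ ℓ' _ hi' _ hℓ' (Or.inr rfl)
        subst this
        exact mem_rows.2 ⟨j, hℓ'⟩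
      dep_iff := fun _ i _ j _ => hiff i j }
  obtain ⟨H, hH, hHf, hHg⟩ := Params.exists_h
    (d := ⟨dep (rowComp f₀ g), k, Z, 0, φ, γ, B, D, κ⟩) h (hpart 0) hconn rfl hZ₀ hfn hgn hf' hg'
    hκ hφ hγ
  refine ⟨⟨dep (rowComp f₀ g), k, Z, H, φ, γ, B, D, κ⟩, rfl, ?_, ?_, hpart H, hconn,
    ⟨hH, hD, hB, hκ0⟩, ⟨hHf, hHg, fun j _ => hφ j, fun i _ => hγ i⟩⟩
  · refine Finset.eq_univ_iff_forall.2 fun i => ?_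
    obtain ⟨j, hj⟩ := (hgn i).dep_nonempty
    exact mem_rows.2 ⟨j, (hZ₀ i j).2 hj⟩
  · refine Finset.eq_univ_iff_forall.2 fun j => ?_
    obtain ⟨i, hi⟩ := (hfn j).dep_nonempty
    exact mem_cols.2 ⟨i, (hZ₀ i j).2 ((hiff i j).2 hi)⟩

end Main

end GenPoly

/-- Characterization of the multilinear generalized polymorphisms in which `f₀` and `g₀` depend on
all their inputs and the functions `f_j` and `g_i` are Boolean-like and non-constant (first part),
and its converse (second part). -/
theorem mainTheorem3 (n m : ℕ)
    (f₀ : Cube (Fin n) → ℝ) (f : Fin m → Cube (Fin n) → ℝ)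
    (g₀ : Cube (Fin m) → ℝ) (g : Fin n → Cube (Fin m) → ℝ) :
    (IsGenPolymorphism f₀ f g₀ g →
      dep f₀ = Finset.univ → dep g₀ = Finset.univ →
      (∀ j, IsBooleanLike (f j) ∧ NonConstant (f j)) →
      (∀ i, IsBooleanLike (g i) ∧ NonConstant (g i)) →
      ∃ d : Params f g,
        d.Z₀ = dep (rowComp f₀ g) ∧ rows d.Z₀ = Finset.univ ∧ cols d.Z₀ = Finset.univ ∧
        d.IsBlockPartition ∧ d.IsConnected ∧ d.IsNormalized ∧ d.Represents f₀ g₀) ∧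
    (∀ d : Params f g,
      (∀ j ∈ cols d.Z₀, IsSignedInput (f j) ∨ 2 ≤ deg (f j)) →
      (∀ i ∈ rows d.Z₀, IsSignedInput (g i) ∨ 2 ≤ deg (g i)) →
      d.IsBlockPartition → d.IsNormalized → d.Represents f₀ g₀ →
      IsGenPolymorphism f₀ f g₀ g) := by
  exact ⟨fun h hf₀ hg₀ hf hg => h.exists_params hf₀ hg₀ hf hg,
    fun _ hf hg hd _ hrep => hrep.isGenPolymorphism hd hf hg⟩
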